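/- For a compact set $S\subset\mathbb{R}^2$ containing a lattice point let $\operatorname{ldiam}(S):=\max_{x,y\in S\cap\mathbb{Z}^2}|\operatorname{conv}\{x,y\}\cap\mathbb{Z}^2|-1$ be its lattice diameter. If $x,y\in S\cap\mathbb{Z}^2$ attain this maximum and $x\neq y$, the line $\operatorname{aff}\{x,y\}$ is called a lattice diameter line of $S$. A lattice polygon is a two-dimensional polytope $P\subset\mathbb{R}^2$ (the convex hull of finitely many points) whose vertices lie in $\mathbb{Z}^2$; it is given as input by the list of its vertices, in any order. **Theorem.** There is a polynomial-time algorithm which, for every lattice polygon $P\subset\mathbb{R}^2$, computes the lattice diameter $\operatorname{ldiam}(P)$ and a finite list of lattice diameter lines of $P$, each given by two distinct lattice points on it, such that for every direction in which $P$ has a lattice diameter line the list contains a line in that direction. Here polynomial time means that the running time on a random access machine with logarithmic cost (every number that is read or computed is charged its bit length) is at most a polynomial, independent of $P$, in $n$ and $\log_2 c$, where $n$ is the number of vertices of $P$ and $c$ is the largest absolute value of a coordinate of a vertex. -/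

import Mathlib

/-!
## Lattice polygons and lattice diameters in the plane
-/

namespace LatticeDiameter

/-- The inclusion of the integer lattice `ℤ²` into `ℝ²`. -/
def toReal (p : ℤ × ℤ) : ℝ × ℝ := ((p.1 : ℝ), (p.2 : ℝ))

/-- The integer lattice as a subset of `ℝ²`. -/
def lattice : Set (ℝ × ℝ) := Set.range toReal

/-- A lattice polygon: a polytope (convex hull of finitely many points) whose affine hull is
the whole plane and whose vertices are lattice points. -/
def IsLatticePolygon (P : Set (ℝ × ℝ)) : Prop :=
  (∃ S : Set (ℝ × ℝ), S.Finite ∧ P = convexHull ℝ S) ∧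
    affineSpan ℝ P = ⊤ ∧ P.extremePoints ℝ ⊆ lattice

/-- `vs` lists the vertices of `P`, each exactly once, in an arbitrary order. -/
def IsVertexList (vs : List (ℤ × ℤ)) (P : Set (ℝ × ℝ)) : Prop :=
  vs.Nodup ∧ toReal '' {v | v ∈ vs} = P.extremePoints ℝ

/-- The number of lattice points on the segment `conv {x, y}`. -/
noncomputable def latticeCount (x y : ℝ × ℝ) : ℕ := (segment ℝ x y ∩ lattice).ncard

/-- The lattice diameter of a bounded set `S`: the maximum of `|conv {x, y} ∩ ℤ²| - 1` over all
`x, y ∈ S ∩ ℤ²`. (The count is at least `1`, so the subtraction is exact, and for a bounded `S`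
the set of values is bounded, so that `sSup` is a maximum.) -/
noncomputable def latticeDiam (S : Set (ℝ × ℝ)) : ℕ :=
  sSup {m : ℕ | ∃ x ∈ S ∩ lattice, ∃ y ∈ S ∩ lattice, m = latticeCount x y - 1}

/-- `conv {x, y}` is a lattice diameter segment of `S`: the lattice points `x, y ∈ S` maximize
the number of lattice points on the segment. -/
def IsDiameterSegment (S : Set (ℝ × ℝ)) (x y : ℝ × ℝ) : Prop :=
  x ∈ S ∩ lattice ∧ y ∈ S ∩ lattice ∧
    ∀ x' ∈ S ∩ lattice, ∀ y' ∈ S ∩ lattice, latticeCount x' y' ≤ latticeCount x y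

/-- `L` is a lattice diameter line of `S`: the affine hull of a lattice diameter segment. -/
def IsDiameterLine (S : Set (ℝ × ℝ)) (L : AffineSubspace ℝ (ℝ × ℝ)) : Prop :=
  ∃ x y, IsDiameterSegment S x y ∧ L = affineSpan ℝ {x, y}

/-- `L` has direction `u`: it is of the form `x + span u`. -/
def HasDirection (L : AffineSubspace ℝ (ℝ × ℝ)) (u : ℝ × ℝ) : Prop :=
  ∃ x, L = AffineSubspace.mk' x (Submodule.span ℝ {u})

/-- The line given by a pair of lattice points on it. -/
def lineThrough (l : (ℤ × ℤ) × (ℤ × ℤ)) : AffineSubspace ℝ (ℝ × ℝ) :=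
  affineSpan ℝ {toReal l.1, toReal l.2}

/-- The largest absolute value of a coordinate of a point in the list. -/
def maxAbsCoord (vs : List (ℤ × ℤ)) : ℕ :=
  vs.toFinset.sup fun v => max v.1.natAbs v.2.natAbs

/-- The input of the algorithm: the coordinates `x₀, y₀, x₁, y₁, …` of the vertices. -/
def encodeVertices (vs : List (ℤ × ℤ)) : List ℤ := vs.flatMap fun v => [v.1, v.2]

/-- The output of the algorithm: a number, followed by lines, each of them as the four
coordinates of two points on it. -/
def encodeOutput (d : ℕ) (ls : List ((ℤ × ℤ) × (ℤ × ℤ))) : List ℤ :=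
  (d : ℤ) :: ls.flatMap fun l => [l.1.1, l.1.2, l.2.1, l.2.2]

end LatticeDiameter

/-!
## Random access machines with logarithmic cost

Structured programs with integer variables and random access arrays of integers. Every evaluation
of a (sub)expression and every command costs at least one step, and every number that is read or
computed, including an array index, is charged its bit length. This is the logarithmic cost
measure, for which polynomial time is the same as for Turing machines.
-/

namespace RAM

/-- A memory state: the values of the variables, and of the cells of the arrays. -/
structure State where
  var : ℕ → ℤ
  arr : ℕ → ℤ → ℤ

/-- Arithmetic expressions; `cell a i` is the entry of array `a` at index `i`. -/
inductive Expr
  | const (c : ℤ)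
  | var (x : ℕ)
  | cell (a : ℕ) (i : Expr)
  | add (e f : Expr)
  | sub (e f : Expr)
  | mul (e f : Expr)
  | div (e f : Expr)

/-- The value of an expression. Division is integer division with nonnegative remainder
(and the machine returns `0` for a division by `0`). -/
def Expr.eval (s : State) : Expr → ℤ
  | .const c => c
  | .var x => s.var x
  | .cell a i => s.arr a (i.eval s)
  | .add e f => e.eval s + f.eval s
  | .sub e f => e.eval s - f.eval s
  | .mul e f => e.eval s * f.eval s
  | .div e f => e.eval s / f.eval s

/-- The bit length of an integer, without its sign. -/
def bitLength (z : ℤ) : ℕ := z.natAbs.size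

/-- The logarithmic cost of the evaluation of an expression: `1` plus the bit length of the value,
summed over all subexpressions. -/
def Expr.cost (s : State) : Expr → ℕ
  | .const c => 1 + bitLength c
  | .var x => 1 + bitLength (s.var x)
  | .cell a i => i.cost s + (1 + bitLength (s.arr a (i.eval s)))
  | .add e f => e.cost s + f.cost s + (1 + bitLength (e.eval s + f.eval s))
  | .sub e f => e.cost s + f.cost s + (1 + bitLength (e.eval s - f.eval s))
  | .mul e f => e.cost s + f.cost s + (1 + bitLength (e.eval s * f.eval s))
  | .div e f => e.cost s + f.cost s + (1 + bitLength (e.eval s / f.eval s))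

/-- Programs. The conditions of `cond` and `loop` test whether an expression is positive. -/
inductive Prog
  | skip
  | assign (x : ℕ) (e : Expr)
  | store (a : ℕ) (i e : Expr)
  | seq (p q : Prog)
  | cond (c : Expr) (p q : Prog)
  | loop (c : Expr) (p : Prog)

/-- The state after the assignment `x := z`. -/
def State.setVar (s : State) (x : ℕ) (z : ℤ) : State :=
  { s with var := Function.update s.var x z }

/-- The state after the assignment `a[i] := z`. -/
def State.setCell (s : State) (a : ℕ) (i z : ℤ) : State :=
  { s with arr := Function.update s.arr a (Function.update (s.arr a) i z) }

/-- `Exec p s t s'`: the program `p`, started in the state `s`, halts in the state `s'`, and the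
cost of the run is `t`. -/
inductive Exec : Prog → State → ℕ → State → Prop
  | skip (s : State) : Exec .skip s 1 s
  | assign (s : State) (x : ℕ) (e : Expr) :
      Exec (.assign x e) s (e.cost s + 1) (s.setVar x (e.eval s))
  | store (s : State) (a : ℕ) (i e : Expr) :
      Exec (.store a i e) s (i.cost s + e.cost s + 1) (s.setCell a (i.eval s) (e.eval s))
  | seq {p q : Prog} {s s' s'' : State} {t t' : ℕ} :
      Exec p s t s' → Exec q s' t' s'' → Exec (.seq p q) s (t + t') s''
  | cond_pos {c : Expr} {p q : Prog} {s s' : State} {t : ℕ} :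
      0 < c.eval s → Exec p s t s' → Exec (.cond c p q) s (c.cost s + 1 + t) s'
  | cond_neg {c : Expr} {p q : Prog} {s s' : State} {t : ℕ} :
      ¬ 0 < c.eval s → Exec q s t s' → Exec (.cond c p q) s (c.cost s + 1 + t) s'
  | loop_pos {c : Expr} {p : Prog} {s s' s'' : State} {t t' : ℕ} :
      0 < c.eval s → Exec p s t s' → Exec (.loop c p) s' t' s'' →
        Exec (.loop c p) s (c.cost s + 1 + t + t') s''
  | loop_neg {c : Expr} {p : Prog} {s : State} :
      ¬ 0 < c.eval s → Exec (.loop c p) s (c.cost s + 1) s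

/-- Programs are deterministic: the cost and the final state of a run are determined by the
program and the initial state. -/
theorem Exec.deterministic {p : Prog} {s s₁ s₂ : State} {t₁ t₂ : ℕ}
    (h₁ : Exec p s t₁ s₁) (h₂ : Exec p s t₂ s₂) : t₁ = t₂ ∧ s₁ = s₂ := by
  induction h₁ generalizing t₂ s₂ with
  | skip s => cases h₂; exact ⟨rfl, rfl⟩
  | assign s x e => cases h₂; exact ⟨rfl, rfl⟩
  | store s a i e => cases h₂; exact ⟨rfl, rfl⟩
  | seq _ _ ih ih' =>
    cases h₂ with
    | seq k k' =>
      obtain ⟨rfl, rfl⟩ := ih k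
      obtain ⟨rfl, rfl⟩ := ih' k'
      exact ⟨rfl, rfl⟩
  | cond_pos hc _ ih =>
    cases h₂ with
    | cond_pos _ k => obtain ⟨rfl, rfl⟩ := ih k; exact ⟨rfl, rfl⟩
    | cond_neg hn _ => exact absurd hc hn
  | cond_neg hc _ ih =>
    cases h₂ with
    | cond_pos hn _ => exact absurd hn hc
    | cond_neg _ k => obtain ⟨rfl, rfl⟩ := ih k; exact ⟨rfl, rfl⟩
  | loop_pos hc _ _ ih ih' =>
    cases h₂ with
    | loop_pos _ k k' =>
      obtain ⟨rfl, rfl⟩ := ih k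
      obtain ⟨rfl, rfl⟩ := ih' k'
      exact ⟨rfl, rfl⟩
    | loop_neg hn => exact absurd hc hn
  | loop_neg hc =>
    cases h₂ with
    | loop_pos hn _ _ => exact absurd hn hc
    | loop_neg _ => exact ⟨rfl, rfl⟩

/-- The initial state: the input is in array `0`, from index `0` on, its length is in variable `0`,
and everything else is `0`. -/
def State.init (inp : List ℤ) : State where
  var x := if x = 0 then (inp.length : ℤ) else 0
  arr a i := if a = 0 ∧ 0 ≤ i then inp.getD i.toNat 0 else 0

/-- The output is `out`: it is in array `1`, from index `0` on, and its length is in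
variable `0`. -/
def State.HasOutput (s : State) (out : List ℤ) : Prop :=
  s.var 0 = (out.length : ℤ) ∧ ∀ (i : ℕ) (h : i < out.length), s.arr 1 (i : ℤ) = out[i]

/-- On the input `inp`, the program `p` halts after a run of cost `t` with the output `out`. -/
def Prog.Computes (p : Prog) (inp : List ℤ) (t : ℕ) (out : List ℤ) : Prop :=
  ∃ s : State, Exec p (State.init inp) t s ∧ s.HasOutput out

end RAM

/-! Write d for the lattice diameter of the polygon P. A diameter line comes from a chord from x to
x + d v with v a nonzero integer vector. Two facts turn the problem into a small search.

First, a chord of P in direction u can be translated, without losing length, until one end is a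
vertex w of P. On the interval of offsets where an upper and a lower segment between vertices
coexist, their distance is affine, so it is largest at an end of the interval, which is the offset
of a vertex (`exists_vertex_chord`). As w is a lattice point, a chord k u with k integral becomes
the lattice chord from w to w + k u or w - k u. It lies in a triangle w, a, b of vertices, where the
largest k is the floor of a quotient of determinants (`exists_vertex_triple`, `add_smul_mem_hull`).
For a given direction it therefore suffices to try all triples of vertices.

Second, only boundedly many directions matter. Let w, w + e, w + e' be a triangle of maximal area on
vertices, let D = `cross e e'`, and let Q(u) = (u × e)² + (u × e')². By maximality P lies in the
strips |(p - w) × e| ≤ D and |(p - w) × e'| ≤ D, so a chord d v satisfies d² Q(v) ≤ 8 D². Conversely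
the triangle contains a chord k u whenever k (|u × e| + |u × e'|) ≤ D. By the first fact this fails
for k = d + 1. Together these give Q(v) < 64 Q(u) for every nonzero integer u
(`IsMaxTriangle.form_lt`). In a Lagrange-Gauss reduced basis for Q, v then has coefficients of
absolute value at most 16 (`abs_coeff_le`), which leaves 33² = 1089 candidates.

The program finds the triangle by trying all n³ triples, reduces the basis, and tries all 1089 n³
pairs of candidate and triple, keeping the longest lattice chords. Each chord found is a genuine
chord of P, so the search never exceeds d, and every diameter direction occurs among its steps
(`exists_valid_step`).

For the cost, all stored numbers stay below 2 ^ L between iterations, with L linear in n + log c. A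
loop-free piece of program then costs at most a constant times L (`Prog.LoopFree.exec`), and the
loops run n³, O(L) and 1089 n³ times. -/

namespace RAM

/-! ### Cost of loop-free programs and of loops on states with bounded entries -/

/-- All variables and cells have absolute value at most `2 ^ L`. -/
def State.Bounded (s : State) (L : ℕ) : Prop :=
  (∀ x, |s.var x| ≤ 2 ^ L) ∧ ∀ a i, |s.arr a i| ≤ 2 ^ L

/-- In a state bounded by `2 ^ L`, the value of `e` is at most `2 ^ (L * e.weight)`. -/
def Expr.weight : Expr → ℕ
  | .const c => bitLength c + 1
  | .var _ => 1
  | .cell _ _ => 1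
  | .add e f => e.weight + f.weight
  | .sub e f => e.weight + f.weight
  | .mul e f => e.weight + f.weight
  | .div e f => e.weight + f.weight

/-- In a state bounded by `2 ^ L`, the evaluation of `e` costs at most `e.costFactor * L`. -/
def Expr.costFactor : Expr → ℕ
  | .const c => bitLength c + 1
  | .var _ => 3
  | .cell _ i => i.costFactor + 3
  | .add e f => e.costFactor + f.costFactor + (e.weight + f.weight + 2)
  | .sub e f => e.costFactor + f.costFactor + (e.weight + f.weight + 2)
  | .mul e f => e.costFactor + f.costFactor + (e.weight + f.weight + 2)
  | .div e f => e.costFactor + f.costFactor + (e.weight + f.weight + 2)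

/-- Programs without loops. -/
def Prog.LoopFree : Prog → Prop
  | .skip => True
  | .assign _ _ => True
  | .store _ _ _ => True
  | .seq p q => p.LoopFree ∧ q.LoopFree
  | .cond _ p q => p.LoopFree ∧ q.LoopFree
  | .loop _ _ => False

/-- The final state of a run of a program without loops. -/
def Prog.denote : Prog → State → State
  | .skip, s => s
  | .assign x e, s => s.setVar x (e.eval s)
  | .store a i e, s => s.setCell a (i.eval s) (e.eval s)
  | .seq p q, s => q.denote (p.denote s)
  | .cond c p q, s => if 0 < c.eval s then p.denote s else q.denote s
  | .loop _ _, s => s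

/-- A program without loops turns a state bounded by `2 ^ L` into one bounded by
`2 ^ (L * p.growth)`. -/
def Prog.growth : Prog → ℕ
  | .skip => 1
  | .assign _ e => e.weight
  | .store _ _ e => e.weight
  | .seq p q => p.growth * q.growth
  | .cond _ p q => p.growth * q.growth
  | .loop _ _ => 1

/-- In a state bounded by `2 ^ L`, a run of `p` costs at most `p.costFactor * L`. -/
def Prog.costFactor : Prog → ℕ
  | .skip => 1
  | .assign _ e => e.costFactor + 1
  | .store _ i e => i.costFactor + e.costFactor + 1
  | .seq p q => p.costFactor + p.growth * q.costFactor
  | .cond c p q => c.costFactor + 1 + (p.costFactor + q.costFactor)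
  | .loop c p => c.costFactor + 1 + p.costFactor

theorem Expr.one_le_weight (e : Expr) : 1 ≤ e.weight := by
  induction e <;> simp only [weight] <;> omega

theorem Prog.one_le_growth (p : Prog) : 1 ≤ p.growth := by
  induction p with
  | skip => exact le_rfl
  | assign x e => exact e.one_le_weight
  | store a i e => exact e.one_le_weight
  | seq p q hp hq => exact Nat.mul_pos hp hq
  | cond c p q hp hq => exact Nat.mul_pos hp hq
  | loop c p _ => exact le_rfl

theorem State.Bounded.mono {s : State} {L M : ℕ} (h : s.Bounded L) (hLM : L ≤ M) :
    s.Bounded M := by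
  have : (2 : ℤ) ^ L ≤ 2 ^ M := pow_le_pow_right₀ (by norm_num) hLM
  exact ⟨fun x => (h.1 x).trans this, fun a i => (h.2 a i).trans this⟩

theorem State.Bounded.setVar {s : State} {L : ℕ} (h : s.Bounded L) {z : ℤ} (x : ℕ)
    (hz : |z| ≤ 2 ^ L) : (s.setVar x z).Bounded L := by
  refine ⟨fun y => ?_, h.2⟩
  by_cases hy : y = x
  · subst hy; simpa [State.setVar] using hz
  · simpa [State.setVar, hy] using h.1 y

theorem State.Bounded.setCell {s : State} {L : ℕ} (h : s.Bounded L) {z : ℤ} (a : ℕ) (i : ℤ)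
    (hz : |z| ≤ 2 ^ L) : (s.setCell a i z).Bounded L := by
  refine ⟨h.1, fun b j => ?_⟩
  by_cases hb : b = a
  · subst hb
    by_cases hj : j = i
    · subst hj; simpa [State.setCell] using hz
    · simpa [State.setCell, hj] using h.2 b j
  · simpa [State.setCell, hb] using h.2 b j

theorem bitLength_le {z : ℤ} {L : ℕ} (h : |z| ≤ 2 ^ L) : bitLength z ≤ L + 1 := by
  rw [bitLength, Nat.size_le]
  have : (z.natAbs : ℤ) ≤ ((2 ^ L : ℕ) : ℤ) := by simpa using h
  have h2 : z.natAbs ≤ 2 ^ L := by exact_mod_cast this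
  exact h2.trans_lt (Nat.pow_lt_pow_right (by norm_num) (Nat.lt_succ_self L))

theorem abs_le_of_bitLength (z : ℤ) : |z| ≤ 2 ^ bitLength z := by
  have : z.natAbs < 2 ^ bitLength z := Nat.lt_size_self _
  have h2 : (z.natAbs : ℤ) ≤ ((2 ^ bitLength z : ℕ) : ℤ) := by exact_mod_cast this.le
  simpa using h2

/-- Lets sums be estimated like products, so that `Expr.weight` is additive for all four operations.
Exponent 0 must be excluded, since 1 + 1 > 1. -/
theorem two_pow_add_two_pow_le {x y : ℕ} (hx : 1 ≤ x) (hy : 1 ≤ y) :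
    (2 : ℤ) ^ x + 2 ^ y ≤ 2 ^ (x + y) := by
  have h1 : (2 : ℤ) ≤ 2 ^ x := by simpa using pow_le_pow_right₀ (show (1 : ℤ) ≤ 2 by norm_num) hx
  have h2 : (2 : ℤ) ≤ 2 ^ y := by simpa using pow_le_pow_right₀ (show (1 : ℤ) ≤ 2 by norm_num) hy
  rw [pow_add]
  nlinarith

theorem Expr.abs_eval_le {s : State} {L : ℕ} (hL : 1 ≤ L) (h : s.Bounded L) (e : Expr) :
    |e.eval s| ≤ 2 ^ (L * e.weight) := by
  have pos : ∀ e : Expr, 1 ≤ L * e.weight := fun e => Nat.mul_pos hL e.one_le_weight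
  induction e with
  | const c =>
    refine (abs_le_of_bitLength c).trans (pow_le_pow_right₀ (by norm_num) ?_)
    simp only [weight]; nlinarith
  | var x => simpa [weight, eval] using h.1 x
  | cell a i _ => simpa [weight, eval] using h.2 a _
  | add e f he hf =>
    simp only [weight, eval, mul_add]
    exact (abs_add_le _ _).trans ((add_le_add he hf).trans (two_pow_add_two_pow_le (pos e) (pos f)))
  | sub e f he hf =>
    simp only [weight, eval, mul_add]
    exact (abs_sub _ _).trans ((add_le_add he hf).trans (two_pow_add_two_pow_le (pos e) (pos f)))
  | mul e f he hf =>
    simp only [weight, eval, mul_add, pow_add, abs_mul]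
    gcongr
  | div e f he hf =>
    simp only [weight, eval, mul_add]
    have : |e.eval s / f.eval s| ≤ |e.eval s| := Int.abs_ediv_le_abs _ _
    exact this.trans (he.trans (pow_le_pow_right₀ (by norm_num) (by omega)))

theorem Expr.cost_le {s : State} {L : ℕ} (hL : 1 ≤ L) (h : s.Bounded L) (e : Expr) :
    e.cost s ≤ e.costFactor * L := by
  have key : ∀ e : Expr, bitLength (e.eval s) ≤ L * e.weight + 1 :=
    fun e => bitLength_le (e.abs_eval_le hL h)
  induction e with
  | const c => simp only [cost, costFactor]; nlinarith
  | var x =>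
    have := bitLength_le (h.1 x)
    simp only [cost, costFactor]; omega
  | cell a i hi =>
    have := bitLength_le (h.2 a (i.eval s))
    simp only [cost, costFactor]; nlinarith
  | add e f he hf =>
    have := key (.add e f)
    simp only [cost, costFactor, weight, eval] at *; nlinarith
  | sub e f he hf =>
    have := key (.sub e f)
    simp only [cost, costFactor, weight, eval] at *; nlinarith
  | mul e f he hf =>
    have := key (.mul e f)
    simp only [cost, costFactor, weight, eval] at *; nlinarith
  | div e f he hf =>
    have := key (.div e f)
    simp only [cost, costFactor, weight, eval] at *; nlinarith

/-- In a sequence the second program starts from the bound `L * p.growth` left by the first. The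
factors depend only on the program text, so the cost is linear in `L`. -/
theorem Prog.LoopFree.exec {p : Prog} (hp : p.LoopFree) {s : State} {L : ℕ} (hL : 1 ≤ L)
    (h : s.Bounded L) :
    (∃ t ≤ p.costFactor * L, Exec p s t (p.denote s)) ∧
      (p.denote s).Bounded (L * p.growth) := by
  induction p generalizing s L with
  | skip => exact ⟨⟨1, by simpa [costFactor] using hL, .skip s⟩, by simpa [growth, denote] using h⟩
  | assign x e =>
    refine ⟨⟨_, ?_, .assign s x e⟩, ?_⟩
    · have := e.cost_le hL h
      simp only [costFactor]; nlinarith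
    · exact (h.mono (Nat.le_mul_of_pos_right L e.one_le_weight)).setVar x (e.abs_eval_le hL h)
  | store a i e =>
    refine ⟨⟨_, ?_, .store s a i e⟩, ?_⟩
    · have := e.cost_le hL h
      have := i.cost_le hL h
      simp only [costFactor]; nlinarith
    · exact (h.mono (Nat.le_mul_of_pos_right L e.one_le_weight)).setCell a _ (e.abs_eval_le hL h)
  | seq p q ihp ihq =>
    obtain ⟨⟨t, ht, hex⟩, hb⟩ := ihp hp.1 hL h
    obtain ⟨⟨t', ht', hex'⟩, hb'⟩ := ihq hp.2 (Nat.mul_pos hL p.one_le_growth) hb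
    refine ⟨⟨t + t', ?_, .seq hex hex'⟩, ?_⟩
    · simp only [costFactor]; nlinarith
    · simpa only [growth, mul_assoc, denote] using hb'
  | cond c p q ihp ihq =>
    obtain ⟨⟨t, ht, hex⟩, hb⟩ := ihp hp.1 hL h
    obtain ⟨⟨t', ht', hex'⟩, hb'⟩ := ihq hp.2 hL h
    have hc := c.cost_le hL h
    by_cases hpos : 0 < c.eval s
    · simp only [denote, if_pos hpos]
      refine ⟨⟨_, ?_, .cond_pos hpos hex⟩, hb.mono ?_⟩
      · simp only [costFactor]; nlinarith
      · exact Nat.mul_le_mul_left L (Nat.le_mul_of_pos_right _ q.one_le_growth)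
    · simp only [denote, if_neg hpos]
      refine ⟨⟨_, ?_, .cond_neg hpos hex'⟩, hb'.mono ?_⟩
      · simp only [costFactor]; nlinarith
      · exact Nat.mul_le_mul_left L (Nat.le_mul_of_pos_left _ p.one_le_growth)
  | loop c p _ => exact hp.elim

/-- A run of `p` from `s` ends in a state satisfying `Q`, and costs at most `t`. -/
def Prog.Runs (p : Prog) (s : State) (t : ℕ) (Q : State → Prop) : Prop :=
  ∃ t' ≤ t, ∃ s', Exec p s t' s' ∧ Q s'

theorem Prog.LoopFree.runs {p : Prog} (hp : p.LoopFree) {s : State} {L : ℕ} (hL : 1 ≤ L)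
    (h : s.Bounded L) {Q : State → Prop} (hQ : Q (p.denote s)) :
    p.Runs s (p.costFactor * L) Q := by
  obtain ⟨⟨t, ht, hex⟩, -⟩ := hp.exec hL h
  exact ⟨t, ht, _, hex, hQ⟩

theorem Prog.Runs.seq {p q : Prog} {s : State} {t t' : ℕ} {Q R : State → Prop}
    (hp : p.Runs s t Q) (hq : ∀ s', Q s' → q.Runs s' t' R) : (p.seq q).Runs s (t + t') R := by
  obtain ⟨u, hu, s', hex, hs'⟩ := hp
  obtain ⟨u', hu', s'', hex', hs''⟩ := hq s' hs'
  exact ⟨u + u', add_le_add hu hu', s'', .seq hex hex', hs''⟩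

/-- A loop whose body has no loops, with an invariant `I k` in which `k` bounds the number of
remaining iterations. -/
theorem Prog.Runs.loop {c : Expr} {p : Prog} (hp : p.LoopFree) {L : ℕ} (hL : 1 ≤ L)
    (I : ℕ → State → Prop) (hb : ∀ k s, I k s → s.Bounded L)
    (step : ∀ k s, I k s → 0 < c.eval s → ∃ k' < k, I k' (p.denote s)) (k : ℕ) (s : State)
    (hs : I k s) :
    (Prog.loop c p).Runs s ((k + 1) * ((Prog.loop c p).costFactor * L))
      fun s' => ¬ 0 < c.eval s' ∧ ∃ k', I k' s' := by
  induction k using Nat.strong_induction_on generalizing s with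
  | _ k ih =>
    have hc := c.cost_le hL (hb k s hs)
    by_cases hpos : 0 < c.eval s
    · obtain ⟨k', hk', hI⟩ := step k s hs hpos
      obtain ⟨⟨t, ht, hex⟩, -⟩ := hp.exec hL (hb k s hs)
      obtain ⟨t', ht', s', hex', hs'⟩ := ih k' hk' _ hI
      refine ⟨_, ?_, s', .loop_pos hpos hex hex', hs'⟩
      have h1 : t' ≤ k * ((Prog.loop c p).costFactor * L) :=
        ht'.trans (Nat.mul_le_mul_right _ hk')
      have h2 : (Prog.loop c p).costFactor * L = c.costFactor * L + L + p.costFactor * L := by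
        simp only [costFactor]; ring
      rw [add_mul, one_mul]
      omega
    · refine ⟨_, ?_, s, .loop_neg hpos, hpos, k, hs⟩
      have h2 : (Prog.loop c p).costFactor * L = c.costFactor * L + L + p.costFactor * L := by
        simp only [costFactor]; ring
      rw [add_mul, one_mul]
      omega

end RAM

/-! ### Moving a longest chord to a vertex -/

namespace LatticeDiameter

/-- The determinant of two plane vectors. -/
def cross {R : Type*} [CommRing R] (p q : R × R) : R := p.1 * q.2 - p.2 * q.1

theorem toReal_add (p q : ℤ × ℤ) : toReal (p + q) = toReal p + toReal q := by
  simp [toReal]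

theorem toReal_sub (p q : ℤ × ℤ) : toReal (p - q) = toReal p - toReal q := by
  simp [toReal]

theorem toReal_smul (k : ℤ) (p : ℤ × ℤ) : toReal (k • p) = (k : ℝ) • toReal p := by
  simp [toReal]

@[simp] theorem toReal_zero : toReal 0 = 0 := by
  ext <;> simp [toReal]

theorem toReal_injective : Function.Injective toReal := by
  intro p q h
  simp only [toReal, Prod.mk.injEq, Int.cast_inj] at h
  exact Prod.ext h.1 h.2

theorem cross_toReal (p q : ℤ × ℤ) : cross (toReal p) (toReal q) = (cross p q : ℤ) := by
  simp [cross, toReal]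

/-- If the weighted points `(s i, h i)` have barycenter `(σ, η)`, then some segment between two of
them passes above the barycenter. -/
theorem exists_segment_above {ι : Type*} (t : Finset ι) (w s h : ι → ℝ) (hw : ∀ i ∈ t, 0 ≤ w i)
    (hw1 : ∑ i ∈ t, w i = 1) {σ η : ℝ} (hs : ∑ i ∈ t, w i * s i = σ)
    (hh : ∑ i ∈ t, w i * h i = η) (hne : ∃ i ∈ t, s i ≠ σ) :
    ∃ i ∈ t, ∃ j ∈ t, s i ≤ σ ∧ σ ≤ s j ∧ s i < s j ∧
      (s j - s i) * η ≤ (s j - σ) * h i + (σ - s i) * h j := by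
  by_contra! hcon
  have hτ : ∑ i ∈ t, w i * (s i - σ) = 0 := by
    simp only [mul_sub, Finset.sum_sub_distrib, ← Finset.sum_mul, hw1, hs]; ring
  have hg : ∑ i ∈ t, w i * (h i - η) = 0 := by
    simp only [mul_sub, Finset.sum_sub_distrib, ← Finset.sum_mul, hw1, hh]; ring
  have hτ' := Finset.sum_filter_add_sum_filter_not t (fun i => s i < σ) (fun i => w i * (s i - σ))
  have hg' := Finset.sum_filter_add_sum_filter_not t (fun i => s i < σ) (fun i => w i * (h i - η))
  set N := t.filter fun i => s i < σ
  set Z := t.filter fun i => ¬ s i < σ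
  -- The double sum is G_N S_Z - S_N G_Z, where S and G are the weighted sums of s - σ and h - η. It
  -- vanishes because S_N = -S_Z and G_N = -G_Z. Since every bracket is negative by `hcon`, all
  -- products of weights across σ vanish.
  have key : ∑ i ∈ N, ∑ j ∈ Z,
      w i * w j * ((s j - σ) * (h i - η) - (s i - σ) * (h j - η)) = 0 := by
    have : ∑ i ∈ N, ∑ j ∈ Z, w i * w j * ((s j - σ) * (h i - η) - (s i - σ) * (h j - η)) =
        (∑ i ∈ N, w i * (h i - η)) * (∑ j ∈ Z, w j * (s j - σ)) -
          (∑ i ∈ N, w i * (s i - σ)) * (∑ j ∈ Z, w j * (h j - η)) := by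
      rw [Finset.sum_mul_sum, Finset.sum_mul_sum, ← Finset.sum_sub_distrib]
      refine Finset.sum_congr rfl fun i _ => ?_
      rw [← Finset.sum_sub_distrib]
      refine Finset.sum_congr rfl fun j _ => ?_
      ring
    rw [this]
    rw [hτ] at hτ'
    rw [hg] at hg'
    rw [eq_neg_of_add_eq_zero_left hτ', eq_neg_of_add_eq_zero_left hg']
    ring
  have neg : ∀ i ∈ N, ∀ j ∈ Z, (s j - σ) * (h i - η) - (s i - σ) * (h j - η) < 0 := by
    intro i hi j hj
    simp only [N, Z, Finset.mem_filter, not_lt] at hi hj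
    have := hcon i hi.1 j hj.1 hi.2.le hj.2 (hi.2.trans_le hj.2)
    linarith
  have nonpos : ∀ i ∈ N, ∀ j ∈ Z,
      w i * w j * ((s j - σ) * (h i - η) - (s i - σ) * (h j - η)) ≤ 0 := fun i hi j hj =>
    mul_nonpos_of_nonneg_of_nonpos
      (mul_nonneg (hw i (Finset.mem_filter.1 hi).1) (hw j (Finset.mem_filter.1 hj).1))
      (neg i hi j hj).le
  have zero : ∀ i ∈ N, ∀ j ∈ Z, w i * w j = 0 := by
    intro i hi j hj
    have h1 := (Finset.sum_eq_zero_iff_of_nonpos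
      fun i hi => Finset.sum_nonpos (nonpos i hi)).1 key i hi
    have h2 := (Finset.sum_eq_zero_iff_of_nonpos (nonpos i hi)).1 h1 j hj
    exact (mul_eq_zero.1 h2).resolve_right (neg i hi j hj).ne
  have zeroN : ∀ i ∈ N, w i = 0 := by
    intro i hi
    by_contra hwi
    have hZ : ∑ j ∈ Z, w j * (s j - σ) = 0 := Finset.sum_eq_zero fun j hj => by
      rw [(mul_eq_zero.1 (zero i hi j hj)).resolve_left hwi, zero_mul]
    rw [hZ, hτ, add_zero] at hτ'
    have hle : ∀ i ∈ N, w i * (s i - σ) ≤ 0 := fun i hi => by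
      have := Finset.mem_filter.1 hi
      exact mul_nonpos_of_nonneg_of_nonpos (hw i this.1) (by linarith [this.2])
    have := (Finset.sum_eq_zero_iff_of_nonpos hle).1 hτ' i hi
    have h3 := (Finset.mem_filter.1 hi).2
    rcases mul_eq_zero.1 this with h | h
    · exact hwi h
    · linarith
  have zeroτ : ∀ i ∈ t, w i * (s i - σ) = 0 := by
    refine (Finset.sum_eq_zero_iff_of_nonneg fun i hi => ?_).1 hτ
    by_cases hi' : s i < σ
    · rw [zeroN i (Finset.mem_filter.2 ⟨hi, hi'⟩), zero_mul]
    · exact mul_nonneg (hw i hi) (by linarith)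
  -- Now all weight sits at s = σ. Some such point has height at least η, and the segment joining it
  -- to any point off σ passes above the barycenter, which contradicts `hcon`.
  obtain ⟨i, hi, hwi, hgi⟩ : ∃ i ∈ t, w i ≠ 0 ∧ 0 ≤ h i - η := by
    by_contra! hno
    have hle : ∀ i ∈ t, w i * (h i - η) ≤ 0 := fun i hi => by
      by_cases hwi : w i = 0
      · simp [hwi]
      · exact mul_nonpos_of_nonneg_of_nonpos (hw i hi) (hno i hi hwi).le
    have hall : ∀ i ∈ t, w i = 0 := fun i hi => by
      by_contra hwi
      exact (mul_eq_zero.1 ((Finset.sum_eq_zero_iff_of_nonpos hle).1 hg i hi)).elim hwi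
        (hno i hi hwi).ne
    rw [Finset.sum_eq_zero hall] at hw1
    exact zero_ne_one hw1
  have hsi : s i = σ := by
    have := (mul_eq_zero.1 (zeroτ i hi)).resolve_left hwi
    linarith
  obtain ⟨j, hj, hsj⟩ := hne
  rcases lt_or_gt_of_ne hsj with hlt | hlt
  · have := hcon j hj i hi hlt.le hsi.ge (hlt.trans_eq hsi.symm)
    rw [hsi] at this
    nlinarith
  · have := hcon i hi j hj hsi.le hlt.le (hsi.trans_lt hlt)
    rw [hsi] at this
    nlinarith

/-- Uses the offset `cross p u` across the direction u as abscissa and the inner product with u as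
height. The sign `c` is 1 for a segment above y and -1 for one below. -/
theorem exists_segment_above_of_mem_convexHull {t : Finset (ℝ × ℝ)} {u y : ℝ × ℝ}
    (hy : y ∈ convexHull ℝ (t : Set (ℝ × ℝ))) (c : ℝ) (hne : ∃ p ∈ t, cross p u ≠ cross y u) :
    ∃ p ∈ t, ∃ q ∈ t, cross p u ≤ cross y u ∧ cross y u ≤ cross q u ∧ cross p u < cross q u ∧
      (cross q u - cross p u) * (c * (y.1 * u.1 + y.2 * u.2)) ≤
        (cross q u - cross y u) * (c * (p.1 * u.1 + p.2 * u.2)) +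
          (cross y u - cross p u) * (c * (q.1 * u.1 + q.2 * u.2)) := by
  obtain ⟨w, hw, hw1, rfl⟩ := Finset.mem_convexHull'.1 hy
  refine exists_segment_above t w (fun p => cross p u)
    (fun p => c * (p.1 * u.1 + p.2 * u.2)) hw hw1 ?_ ?_ hne
  · simp only [cross, Prod.fst_sum, Prod.snd_sum, Finset.sum_mul, ← Finset.sum_sub_distrib]
    refine Finset.sum_congr rfl fun p _ => ?_
    simp only [Prod.smul_fst, Prod.smul_snd, smul_eq_mul]; ring
  · simp only [Prod.fst_sum, Prod.snd_sum, Finset.sum_mul, ← Finset.sum_add_distrib,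
      Finset.mul_sum]
    refine Finset.sum_congr rfl fun p _ => ?_
    simp only [Prod.smul_fst, Prod.smul_snd, smul_eq_mul]; ring

/-- Twice the area of the triangle w, a, b is its width across u times the length of the chord from
w to the line ab. The hypothesis bounds this chord from below in heights, each scaled by |u|², and
`c` tells on which side of ab the vertex w lies. -/
theorem mul_le_abs_cross {w a b u : ℝ × ℝ} (hu : u ≠ 0) {T c : ℝ} (hc : |c| = 1)
    (h : (cross a u - cross b u) * (T * (u.1 ^ 2 + u.2 ^ 2)) ≤
      c * ((cross a u - cross b u) * (w.1 * u.1 + w.2 * u.2) -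
        (cross a u - cross w u) * (b.1 * u.1 + b.2 * u.2) -
        (cross w u - cross b u) * (a.1 * u.1 + a.2 * u.2))) :
    T * (cross (a - w) u - cross (b - w) u) ≤ |cross (a - w) (b - w)| := by
  have hpos : 0 < u.1 ^ 2 + u.2 ^ 2 := by
    by_contra hn
    have h1 : u.1 = 0 := by nlinarith [sq_nonneg u.1, sq_nonneg u.2]
    have h2 : u.2 = 0 := by nlinarith [sq_nonneg u.1, sq_nonneg u.2]
    exact hu (Prod.ext h1 h2)
  have e1 : (cross a u - cross b u) * (w.1 * u.1 + w.2 * u.2) -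
        (cross a u - cross w u) * (b.1 * u.1 + b.2 * u.2) -
        (cross w u - cross b u) * (a.1 * u.1 + a.2 * u.2) =
      - cross (a - w) (b - w) * (u.1 ^ 2 + u.2 ^ 2) := by
    simp only [cross, Prod.fst_sub, Prod.snd_sub]; ring
  have e2 : cross (a - w) u - cross (b - w) u = cross a u - cross b u := by
    simp only [cross, Prod.fst_sub, Prod.snd_sub]; ring
  rw [e1] at h
  rw [e2]
  have h3 : c * (- cross (a - w) (b - w)) ≤ |cross (a - w) (b - w)| := by
    refine (le_abs_self _).trans ?_
    rw [abs_mul, hc, abs_neg, one_mul]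
  have h4 : (T * (cross a u - cross b u)) * (u.1 ^ 2 + u.2 ^ 2) ≤
      |cross (a - w) (b - w)| * (u.1 ^ 2 + u.2 ^ 2) := by nlinarith
  exact le_of_mul_le_mul_right h4 hpos

/-- Among the longest chords of a polygon in direction `u` there is one that passes through a
vertex. -/
theorem exists_vertex_chord {t : Finset (ℝ × ℝ)} {u x y : ℝ × ℝ} {T : ℝ} (hu : u ≠ 0)
    (hx : x ∈ convexHull ℝ (t : Set (ℝ × ℝ))) (hy : y ∈ convexHull ℝ (t : Set (ℝ × ℝ)))
    (hxy : y = x + T • u) (hne : ∃ p ∈ t, cross p u ≠ cross x u) :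
    ∃ w ∈ t, ∃ a ∈ t, ∃ b ∈ t, 0 ≤ cross (a - w) u ∧ cross (b - w) u ≤ 0 ∧
      cross (b - w) u < cross (a - w) u ∧
      T * (cross (a - w) u - cross (b - w) u) ≤ |cross (a - w) (b - w)| := by
  have hσ : cross y u = cross x u := by
    subst hxy
    simp only [cross, Prod.fst_add, Prod.snd_add, Prod.smul_fst, Prod.smul_snd, smul_eq_mul]
    ring
  have hT : y.1 * u.1 + y.2 * u.2 = x.1 * u.1 + x.2 * u.2 + T * (u.1 ^ 2 + u.2 ^ 2) := by
    subst hxy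
    simp only [Prod.fst_add, Prod.snd_add, Prod.smul_fst, Prod.smul_snd, smul_eq_mul]
    ring
  obtain ⟨p, hp, q, hq, hpσ, hqσ, hpq, hU⟩ :=
    exists_segment_above_of_mem_convexHull hy 1 (by rwa [hσ])
  obtain ⟨p', hp', q', hq', hpσ', hqσ', hpq', hU'⟩ :=
    exists_segment_above_of_mem_convexHull hx (-1) hne
  rw [hσ] at hpσ hqσ hU
  set σ := cross x u
  rw [hT] at hU
  have sub_cross : ∀ a w : ℝ × ℝ, cross (a - w) u = cross a u - cross w u := fun a w => by
    simp only [cross, Prod.fst_sub, Prod.snd_sub]; ring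
  generalize hP : cross p u = sp at *
  generalize hQ : cross q u = sq at *
  generalize hP' : cross p' u = sp' at *
  generalize hQ' : cross q' u = sq' at *
  generalize hhx : x.1 * u.1 + x.2 * u.2 = hx₀ at *
  generalize hhp : p.1 * u.1 + p.2 * u.2 = kp at *
  generalize hhq : q.1 * u.1 + q.2 * u.2 = kq at *
  generalize hhp' : p'.1 * u.1 + p'.2 * u.2 = kp' at *
  generalize hhq' : q'.1 * u.1 + q'.2 * u.2 = kq' at *
  generalize hR : T * (u.1 ^ 2 + u.2 ^ 2) = R at *
  have hδ : 0 < sq - sp := by linarith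
  have hδ' : 0 < sq' - sp' := by linarith
  -- The difference of the two segments, scaled, as an affine function of the offset.
  set α := (sq' - sp') * (sq * kp - sp * kq) - (sq - sp) * (sq' * kp' - sp' * kq') with hα
  set β := (sq' - sp') * (kq - kp) - (sq - sp) * (kq' - kp') with hβ
  have hG : (sq - sp) * (sq' - sp') * R ≤ α + β * σ := by
    have h1 := mul_le_mul_of_nonneg_left hU hδ'.le
    have h2 := mul_le_mul_of_nonneg_left hU' hδ.le
    rw [hα, hβ]
    linarith
  -- If the distance of the two segments does not increase with the offset (β ≤ 0), slide left to
  -- the larger of the two left ends, otherwise right to the smaller of the two right ends. The end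
  -- reached is the vertex w, and the other segment becomes the opposite side ab. This gives four
  -- cases.
  have left : β ≤ 0 → sp' ≤ sp → (sq' - sp') * R ≤
      (sq' - sp') * kp - (sq' - sp) * kp' - (sp - sp') * kq' := by
    intro hβ0 _
    refine le_of_mul_le_mul_left ?_ hδ
    have : β * σ ≤ β * sp := mul_le_mul_of_nonpos_left hpσ hβ0
    rw [hα, hβ] at *
    linarith
  have left' : β ≤ 0 → sp ≤ sp' → (sq - sp) * R ≤
      -1 * ((sq - sp) * kp' - (sq - sp') * kp - (sp' - sp) * kq) := by
    intro hβ0 _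
    refine le_of_mul_le_mul_left ?_ hδ'
    have : β * σ ≤ β * sp' := mul_le_mul_of_nonpos_left hpσ' hβ0
    rw [hα, hβ] at *
    linarith
  have right : 0 ≤ β → sq ≤ sq' → (sq' - sp') * R ≤
      (sq' - sp') * kq - (sq' - sq) * kp' - (sq - sp') * kq' := by
    intro hβ0 _
    refine le_of_mul_le_mul_left ?_ hδ
    have : β * σ ≤ β * sq := mul_le_mul_of_nonneg_left hqσ hβ0
    rw [hα, hβ] at *
    linarith
  have right' : 0 ≤ β → sq' ≤ sq → (sq - sp) * R ≤
      -1 * ((sq - sp) * kq' - (sq - sq') * kp - (sq' - sp) * kq) := by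
    intro hβ0 _
    refine le_of_mul_le_mul_left ?_ hδ'
    have : β * σ ≤ β * sq' := mul_le_mul_of_nonneg_left hqσ' hβ0
    rw [hα, hβ] at *
    linarith
  have abs1 : |(1 : ℝ)| = 1 := abs_one
  have abs2 : |(-1 : ℝ)| = 1 := by norm_num
  rcases le_total β 0 with hβ0 | hβ0
  · rcases le_total sp' sp with hc | hc
    · refine ⟨p, hp, q', hq', p', hp', ?_, ?_, ?_, mul_le_abs_cross hu abs1 ?_⟩ <;>
        simp only [sub_cross, hP, hQ', hP', hhp, hhq', hhp', hR, one_mul]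
      iterate 3 linarith
      exact left hβ0 hc
    · refine ⟨p', hp', q, hq, p, hp, ?_, ?_, ?_, mul_le_abs_cross hu abs2 ?_⟩ <;>
        simp only [sub_cross, hP, hQ, hP', hhp, hhq, hhp', hR]
      iterate 3 linarith
      exact left' hβ0 hc
  · rcases le_total sq sq' with hc | hc
    · refine ⟨q, hq, q', hq', p', hp', ?_, ?_, ?_, mul_le_abs_cross hu abs1 ?_⟩ <;>
        simp only [sub_cross, hQ, hQ', hP', hhq, hhq', hhp', hR, one_mul]
      iterate 3 linarith
      exact right hβ0 hc
    · refine ⟨q', hq', q, hq, p, hp, ?_, ?_, ?_, mul_le_abs_cross hu abs2 ?_⟩ <;>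
        simp only [sub_cross, hP, hQ, hQ', hhp, hhq, hhq', hR]
      iterate 3 linarith
      exact right' hβ0 hc

/-- The convex hull of a finite set of lattice points. -/
abbrev hull (V : Finset (ℤ × ℤ)) : Set (ℝ × ℝ) := convexHull ℝ (toReal '' V)

/-- Otherwise the polygon would lie on a level line of the functional p ↦ `cross p u`, and so would
the whole plane. Evaluating at the origin and the unit vectors forces u = 0. -/
theorem exists_cross_ne {V : Finset (ℤ × ℤ)} (hspan : affineSpan ℝ (hull V) = ⊤) {u : ℝ × ℝ}
    (hu : u ≠ 0) (σ : ℝ) : ∃ p ∈ V, cross (toReal p) u ≠ σ := by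
  by_contra! hcon
  let f : ℝ × ℝ →ₗ[ℝ] ℝ := u.2 • LinearMap.fst ℝ ℝ ℝ - u.1 • LinearMap.snd ℝ ℝ ℝ
  have hf : ∀ p, f p = cross p u := fun p => by simp [f, cross]; ring
  have hle : affineSpan ℝ (toReal '' (V : Set (ℤ × ℤ))) ≤
      (AffineSubspace.mk' σ (⊥ : Submodule ℝ ℝ)).comap f.toAffineMap := by
    rw [affineSpan_le]
    rintro _ ⟨p, hp, rfl⟩
    simp [hf, hcon p hp]
  rw [affineSpan_convexHull] at hspan
  rw [hspan] at hle
  have all : ∀ p : ℝ × ℝ, cross p u = σ := fun p => by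
    have := hle (AffineSubspace.mem_top ℝ _ p)
    simpa [hf, sub_eq_zero] using this
  have h0 := all 0
  have h1 := all (1, 0)
  have h2 := all (0, 1)
  simp [cross] at h0 h1 h2
  exact hu (Prod.ext (by simp; linarith) (by simp; linarith))

/-- A chord `k • u` of a lattice polygon is certified by a triple of vertices. -/
theorem exists_vertex_triple {V : Finset (ℤ × ℤ)} (hspan : affineSpan ℝ (hull V) = ⊤)
    {u : ℤ × ℤ} (hu : u ≠ 0) {k : ℤ} {x y : ℝ × ℝ} (hx : x ∈ hull V) (hy : y ∈ hull V)
    (hxy : y = x + (k : ℝ) • toReal u) :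
    ∃ u', (u' = u ∨ u' = -u) ∧ ∃ w ∈ V, ∃ a ∈ V, ∃ b ∈ V, 0 ≤ cross (a - w) u' ∧
      cross (b - w) u' ≤ 0 ∧ cross (b - w) u' < cross (a - w) u' ∧
      k * (cross (a - w) u' - cross (b - w) u') ≤ cross (a - w) (b - w) := by
  classical
  have hu' : toReal u ≠ 0 := fun h => hu (toReal_injective (h.trans toReal_zero.symm))
  have hcoe : (toReal '' (V : Set (ℤ × ℤ))) = ((V.image toReal : Finset (ℝ × ℝ)) : Set (ℝ × ℝ)) := by
    simp
  obtain ⟨p₀, hp₀, hp₀'⟩ := exists_cross_ne hspan hu' (cross x (toReal u))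
  rw [hull, hcoe] at hx hy
  obtain ⟨w, hw, a, ha, b, hb, h1, h2, h3, h4⟩ := exists_vertex_chord hu' hx hy hxy
    ⟨_, Finset.mem_image_of_mem _ hp₀, hp₀'⟩
  simp only [Finset.mem_image] at hw ha hb
  obtain ⟨w, hw, rfl⟩ := hw
  obtain ⟨a, ha, rfl⟩ := ha
  obtain ⟨b, hb, rfl⟩ := hb
  simp only [← toReal_sub, cross_toReal] at h1 h2 h3 h4
  norm_cast at h1 h2 h3 h4
  have neg_cross : ∀ p : ℤ × ℤ, cross p (-u) = - cross p u := fun p => by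
    simp [cross]; ring
  have swap_cross : ∀ p q : ℤ × ℤ, cross p q = - cross q p := fun p q => by
    simp [cross]; ring
  rcases le_total 0 (cross (a - w) (b - w)) with hD | hD
  · rw [abs_of_nonneg hD] at h4
    exact ⟨u, .inl rfl, w, hw, a, ha, b, hb, h1, h2, h3, h4⟩
  · rw [abs_of_nonpos hD] at h4
    -- With negative orientation the chord leaves w in direction -u. Reversing u and exchanging a
    -- and b makes the determinant positive and keeps the signs of the offsets.
    refine ⟨-u, .inr rfl, w, hw, b, hb, a, ha, ?_, ?_, ?_, ?_⟩ <;> simp only [neg_cross]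
    · omega
    · omega
    · omega
    · rw [swap_cross (b - w) (a - w)]
      linarith

/-- By Cramer's rule, D u = (a - w) × u · (b - w) - (b - w) × u · (a - w) with D = (a - w) × (b -
w). Hence w + k u is a combination of w, a, b whose weights are nonnegative by the sign conditions
and `h4`. The case k = 0 is separate because D may then fail to be positive. -/
theorem add_smul_mem_hull {V : Finset (ℤ × ℤ)} {u w a b : ℤ × ℤ} (hw : w ∈ V) (ha : a ∈ V)
    (hb : b ∈ V) (h1 : 0 ≤ cross (a - w) u) (h2 : cross (b - w) u ≤ 0)
    (h3 : cross (b - w) u < cross (a - w) u) {k : ℤ} (hk : 0 ≤ k)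
    (h4 : k * (cross (a - w) u - cross (b - w) u) ≤ cross (a - w) (b - w)) :
    toReal (w + k • u) ∈ hull V := by
  have hw' : toReal w ∈ hull V := subset_convexHull ℝ _ ⟨w, hw, rfl⟩
  have ha' : toReal a ∈ hull V := subset_convexHull ℝ _ ⟨a, ha, rfl⟩
  have hb' : toReal b ∈ hull V := subset_convexHull ℝ _ ⟨b, hb, rfl⟩
  rcases hk.eq_or_lt with rfl | hk
  · simpa using hw'
  have hD : 0 < cross (a - w) (b - w) := lt_of_lt_of_le (mul_pos hk (by omega)) h4
  have hconv := convex_convexHull ℝ (toReal '' (V : Set (ℤ × ℤ)))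
  have id1 : cross (a - w) (b - w) * u.1 =
      cross (a - w) u * (b.1 - w.1) - cross (b - w) u * (a.1 - w.1) := by
    simp only [cross, Prod.fst_sub, Prod.snd_sub]; ring
  have id2 : cross (a - w) (b - w) * u.2 =
      cross (a - w) u * (b.2 - w.2) - cross (b - w) u * (a.2 - w.2) := by
    simp only [cross, Prod.fst_sub, Prod.snd_sub]; ring
  generalize cross (a - w) u = sa at *
  generalize cross (b - w) u = sb at *
  generalize cross (a - w) (b - w) = D at *
  have hD' : (0 : ℝ) < D := by exact_mod_cast hD
  have h1' : (0 : ℝ) ≤ sa := by exact_mod_cast h1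
  have h2' : (sb : ℝ) ≤ 0 := by exact_mod_cast h2
  have h4' : (k : ℝ) * (sa - sb) ≤ D := by exact_mod_cast h4
  have hk' : (0 : ℝ) < k := by exact_mod_cast hk
  have id1' : (D : ℝ) * u.1 = sa * (b.1 - w.1) - sb * (a.1 - w.1) := by exact_mod_cast id1
  have id2' : (D : ℝ) * u.2 = sa * (b.2 - w.2) - sb * (a.2 - w.2) := by exact_mod_cast id2
  have := hconv.sum_mem (t := Finset.univ) 
    (w := ![(1 - k * (sa - sb) / D : ℝ), k * (-sb) / D, k * sa / D])
    (z := ![toReal w, toReal a, toReal b]) ?_ ?_ ?_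
  · convert this using 1
    simp only [Fin.sum_univ_three, Matrix.cons_val_zero, Matrix.cons_val_one, Matrix.cons_val]
    have e1 : (u.1 : ℝ) = (sa * (b.1 - w.1) - sb * (a.1 - w.1)) / D := by
      rw [← id1']; field_simp
    have e2 : (u.2 : ℝ) = (sa * (b.2 - w.2) - sb * (a.2 - w.2)) / D := by
      rw [← id2']; field_simp
    ext
    · simp [toReal, e1]; field_simp; ring
    · simp [toReal, e2]; field_simp; ring
  · intro i _
    fin_cases i
    · simp only [Fin.zero_eta, Matrix.cons_val_zero, sub_nonneg]
      rw [div_le_one hD']; exact h4'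
    · simp only [Fin.mk_one, Matrix.cons_val_one, Matrix.cons_val_zero]
      exact div_nonneg (mul_nonneg hk'.le (by linarith)) hD'.le
    · simp only [Fin.reduceFinMk, Matrix.cons_val]
      positivity
  · simp only [Fin.sum_univ_three, Matrix.cons_val_zero, Matrix.cons_val_one, Matrix.cons_val]
    field_simp; ring
  · intro i _
    fin_cases i <;> simpa

end LatticeDiameter

/-! ### Lattice points on segments, diameter segments and directions -/

namespace LatticeDiameter

theorem cross_convex_le {V : Finset (ℤ × ℤ)} {e : ℝ × ℝ} {x : ℝ × ℝ} (hx : x ∈ hull V) {A : ℝ}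
    (h : ∀ p ∈ V, cross (toReal p) e ≤ A) : cross x e ≤ A := by
  have hc : Convex ℝ {p : ℝ × ℝ | cross p e ≤ A} := by
    intro p hp q hq a b ha hb hab
    have h1 := mul_le_mul_of_nonneg_left (show cross p e ≤ A from hp) ha
    have h2 := mul_le_mul_of_nonneg_left (show cross q e ≤ A from hq) hb
    have h3 : cross (a • p + b • q) e = a * cross p e + b * cross q e := by
      simp only [cross, Prod.fst_add, Prod.snd_add, Prod.smul_fst, Prod.smul_snd, smul_eq_mul]
      ring
    have h4 : A = a * A + b * A := by rw [← add_mul, hab, one_mul]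
    change cross (a • p + b • q) e ≤ A
    linarith
  refine convexHull_min ?_ hc hx
  rintro _ ⟨p, hp, rfl⟩
  exact h p hp

/-- The lattice points of a segment, for a primitive direction `u`. -/
theorem latticeCount_smul_of_isCoprime (x u : ℤ × ℤ) (hu : IsCoprime u.1 u.2) (m : ℕ) :
    latticeCount (toReal x) (toReal (x + (m : ℤ) • u)) = m + 1 := by
  have hinj : Function.Injective fun j : ℕ => toReal (x + (j : ℤ) • u) := by
    intro i j hij
    have h1 := add_left_cancel (toReal_injective hij)
    have hu0 : u.1 ≠ 0 ∨ u.2 ≠ 0 := by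
      by_contra! h
      rw [h.1, h.2] at hu
      exact not_isCoprime_zero_zero hu
    simp only [Prod.ext_iff, Prod.smul_fst, Prod.smul_snd, smul_eq_mul] at h1
    rcases hu0 with h | h
    · exact_mod_cast mul_right_cancel₀ h h1.1
    · exact_mod_cast mul_right_cancel₀ h h1.2
  have hset : segment ℝ (toReal x) (toReal (x + (m : ℤ) • u)) ∩ lattice =
      (fun j : ℕ => toReal (x + (j : ℤ) • u)) '' (Finset.range (m + 1) : Set ℕ) := by
    ext z
    constructor
    · rintro ⟨hz, ⟨z, rfl⟩⟩
      rw [segment_eq_image'] at hz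
      obtain ⟨θ, ⟨hθ0, hθ1⟩, hz⟩ := hz
      simp only [toReal, Prod.ext_iff, Prod.fst_add, Prod.snd_add, Prod.smul_fst, Prod.smul_snd,
        Prod.fst_sub, Prod.snd_sub, smul_eq_mul, Int.cast_add, Int.cast_mul, Int.cast_natCast] at hz
      obtain ⟨α, β, hαβ⟩ := hu
      have hαβ' : (α : ℝ) * u.1 + β * u.2 = 1 := by exact_mod_cast hαβ
      -- Applying the Bézout combination of the coordinates of u to z - x shows that the real
      -- parameter along u is an integer.
      have hj : θ * m = ((α * (z.1 - x.1) + β * (z.2 - x.2) : ℤ) : ℝ) := by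
        push_cast
        linear_combination α * hz.1 + β * hz.2 - θ * m * hαβ'
      generalize α * (z.1 - x.1) + β * (z.2 - x.2) = j at hj
      have hm : (0 : ℝ) ≤ m := by positivity
      have hj0 : 0 ≤ j := by
        have : (0 : ℝ) ≤ j := by rw [← hj]; positivity
        exact_mod_cast this
      have hjm : j ≤ m := by
        have : (j : ℝ) ≤ m := by rw [← hj]; nlinarith
        exact_mod_cast this
      lift j to ℕ using hj0
      refine ⟨j, by simp; omega, ?_⟩
      simp only [Int.cast_natCast] at hj
      ext
      · simp [toReal, ← hj]; linarith [hz.1]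
      · simp [toReal, ← hj]; linarith [hz.2]
    · rintro ⟨j, hj, rfl⟩
      simp only [Finset.coe_range, Set.mem_Iio] at hj
      refine ⟨?_, ⟨_, rfl⟩⟩
      rw [segment_eq_image']
      rcases Nat.eq_zero_or_pos m with rfl | hm
      · have : j = 0 := by omega
        subst this
        exact ⟨0, by simp⟩
      have hm' : (0 : ℝ) < m := by exact_mod_cast hm
      refine ⟨j / m, ⟨by positivity, ?_⟩, ?_⟩
      · rw [div_le_one hm']
        exact_mod_cast Nat.lt_succ_iff.1 hj
      · ext
        · simp [toReal]; field_simp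
        · simp [toReal]; field_simp
  rw [latticeCount, hset, Set.ncard_image_of_injective _ hinj, Set.ncard_coe_finset,
    Finset.card_range]

theorem exists_eq_gcd_smul (v : ℤ × ℤ) :
    ∃ u : ℤ × ℤ, IsCoprime u.1 u.2 ∧ v = (Int.gcd v.1 v.2 : ℤ) • u := by
  by_cases h : Int.gcd v.1 v.2 = 0
  -- For v = 0 any primitive vector serves, with multiplier 0, so u is nonzero in all cases.
  · refine ⟨(1, 0), isCoprime_one_left, ?_⟩
    have := Int.gcd_eq_zero_iff.1 h
    ext <;> simp [this.1, this.2]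
  · have hpos : 0 < Int.gcd v.1 v.2 := Nat.pos_of_ne_zero h
    refine ⟨(v.1 / Int.gcd v.1 v.2, v.2 / Int.gcd v.1 v.2), ?_, ?_⟩
    · rw [Int.isCoprime_iff_gcd_eq_one]
      exact Int.gcd_ediv_gcd_ediv_gcd hpos
    · ext
      · exact (Int.mul_ediv_cancel' (Int.gcd_dvd_left ..)).symm
      · exact (Int.mul_ediv_cancel' (Int.gcd_dvd_right ..)).symm

theorem latticeCount_toReal (x y : ℤ × ℤ) :
    latticeCount (toReal x) (toReal y) = Int.gcd (y.1 - x.1) (y.2 - x.2) + 1 := by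
  obtain ⟨u, hu, hv⟩ := exists_eq_gcd_smul (y - x)
  have := latticeCount_smul_of_isCoprime x u hu (Int.gcd (y - x).1 (y - x).2)
  rwa [← hv, add_sub_cancel] at this

/-- Only an inequality, because u need not be primitive. This allows candidate directions to be used
without checking coprimality. -/
theorem succ_le_latticeCount {u : ℤ × ℤ} (hu : u ≠ 0) (x : ℤ × ℤ) (k : ℕ) :
    k + 1 ≤ latticeCount (toReal x) (toReal (x + (k : ℤ) • u)) := by
  rw [latticeCount_toReal]
  simp only [Prod.fst_add, Prod.snd_add, Prod.smul_fst, Prod.smul_snd, smul_eq_mul,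
    add_sub_cancel_left, Int.gcd_mul_left, Int.natAbs_natCast]
  have : 0 < Int.gcd u.1 u.2 := by
    rw [Int.gcd_pos_iff]
    by_contra! h
    exact hu (Prod.ext h.1 h.2)
  nlinarith

/-- Needed because `sSup` of an unbounded set of naturals is the default value 0. The hull lies in a
box of radius R, and a gcd is at most the absolute value of a nonzero entry. -/
theorem bddAbove_latticeDiam (V : Finset (ℤ × ℤ)) :
    BddAbove {m : ℕ | ∃ x ∈ hull V ∩ lattice, ∃ y ∈ hull V ∩ lattice,
      m = latticeCount x y - 1} := by
  obtain ⟨R, hR⟩ : ∃ R : ℕ, ∀ p ∈ V, |p.1| ≤ R ∧ |p.2| ≤ R := by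
    refine ⟨V.sup fun p => max p.1.natAbs p.2.natAbs, fun p hp => ?_⟩
    have := Finset.le_sup (f := fun p : ℤ × ℤ => max p.1.natAbs p.2.natAbs) hp
    simp only [abs_le]
    omega
  have hbox : ∀ z : ℤ × ℤ, toReal z ∈ hull V → |z.1| ≤ R ∧ |z.2| ≤ R := by
    intro z hz
    have h1 := cross_convex_le (e := (0, 1)) (A := R) hz fun p hp => by
      simp only [cross, toReal]; have := (abs_le.1 (hR p hp).1).2; norm_num; exact_mod_cast this
    have h2 := cross_convex_le (e := (0, -1)) (A := R) hz fun p hp => by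
      simp only [cross, toReal]; have := (abs_le.1 (hR p hp).1).1
      have : -(p.1 : ℝ) ≤ R := by exact_mod_cast (by omega : -p.1 ≤ R)
      norm_num; exact this
    have h3 := cross_convex_le (e := (-1, 0)) (A := R) hz fun p hp => by
      simp only [cross, toReal]; have := (abs_le.1 (hR p hp).2).2; norm_num; exact_mod_cast this
    have h4 := cross_convex_le (e := (1, 0)) (A := R) hz fun p hp => by
      simp only [cross, toReal]; have := (abs_le.1 (hR p hp).2).1
      have : -(p.2 : ℝ) ≤ R := by exact_mod_cast (by omega : -p.2 ≤ R)
      norm_num; exact this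
    simp only [cross, toReal] at h1 h2 h3 h4
    norm_num at h1 h2 h3 h4
    norm_cast at h1 h2 h3 h4
    exact ⟨abs_le.2 ⟨by omega, by omega⟩, abs_le.2 ⟨by omega, by omega⟩⟩
  refine ⟨2 * R, ?_⟩
  rintro _ ⟨_, ⟨hx, x, rfl⟩, _, ⟨hy, y, rfl⟩, rfl⟩
  have hx' := hbox x hx
  have hy' := hbox y hy
  rw [latticeCount_toReal, Nat.add_sub_cancel]
  simp only [abs_le] at hx' hy'
  by_cases h1 : y.1 - x.1 = 0
  · rw [h1, Int.gcd_zero_left]; omega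
  · have := Int.gcd_le_natAbs_left (y.2 - x.2) h1
    omega

theorem le_latticeDiam {V : Finset (ℤ × ℤ)} {x u : ℤ × ℤ} (hu : u ≠ 0) {k : ℕ}
    (hx : toReal x ∈ hull V) (hy : toReal (x + (k : ℤ) • u) ∈ hull V) :
    k ≤ latticeDiam (hull V) := by
  have h1 : latticeCount (toReal x) (toReal (x + (k : ℤ) • u)) - 1 ≤ latticeDiam (hull V) :=
    le_csSup (bddAbove_latticeDiam V) ⟨_, ⟨hx, x, rfl⟩, _, ⟨hy, _, rfl⟩, rfl⟩
  have := succ_le_latticeCount hu x k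
  omega

/-- Two distinct vertices suffice. Hence diameter segments have distinct ends, and `IsDiameterLine`,
which does not ask for this, speaks of lines only. -/
theorem one_le_latticeDiam {V : Finset (ℤ × ℤ)} (hspan : affineSpan ℝ (hull V) = ⊤) :
    1 ≤ latticeDiam (hull V) := by
  have hne : (1, 0) ≠ (0 : ℝ × ℝ) := by simp
  obtain ⟨p, hp, -⟩ := exists_cross_ne hspan hne 0
  obtain ⟨q, hq, hpq⟩ := exists_cross_ne hspan hne (cross (toReal p) (1, 0))
  refine le_latticeDiam (x := p) (u := q - p) ?_ (subset_convexHull ℝ _ ⟨p, hp, rfl⟩)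
    (subset_convexHull ℝ _ ⟨q, hq, by simp⟩)
  rintro h
  exact hpq (by rw [sub_eq_zero.1 h])

theorem IsDiameterSegment.latticeCount_eq {V : Finset (ℤ × ℤ)} {x y : ℝ × ℝ}
    (h : IsDiameterSegment (hull V) x y) : latticeCount x y = latticeDiam (hull V) + 1 := by
  have h1 : latticeCount x y - 1 = latticeDiam (hull V) := by
    refine le_antisymm (le_csSup (bddAbove_latticeDiam V) ⟨x, h.1, y, h.2.1, rfl⟩)
      (csSup_le' ?_)
    rintro _ ⟨x', hx', y', hy', rfl⟩
    exact Nat.sub_le_sub_right (h.2.2 x' hx' y' hy') 1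
  obtain ⟨⟨-, x, rfl⟩, ⟨-, y, rfl⟩, -⟩ := h
  rw [latticeCount_toReal] at *
  omega

theorem exists_latticeDiam {V : Finset (ℤ × ℤ)} (hspan : affineSpan ℝ (hull V) = ⊤) :
    ∃ x u : ℤ × ℤ, u ≠ 0 ∧ toReal x ∈ hull V ∧
      toReal (x + (latticeDiam (hull V) : ℤ) • u) ∈ hull V := by
  obtain ⟨p, hp, -⟩ := exists_cross_ne hspan (u := (1, 0)) (by simp) 0
  have hp' : toReal p ∈ hull V := subset_convexHull ℝ _ ⟨p, hp, rfl⟩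
  obtain ⟨_, ⟨hx, x, rfl⟩, _, ⟨hy, y, rfl⟩, hm⟩ := Nat.sSup_mem
    (s := {m : ℕ | ∃ x ∈ hull V ∩ lattice, ∃ y ∈ hull V ∩ lattice, m = latticeCount x y - 1})
    ⟨_, _, ⟨hp', p, rfl⟩, _, ⟨hp', p, rfl⟩, rfl⟩ (bddAbove_latticeDiam V)
  obtain ⟨u, hu, hv⟩ := exists_eq_gcd_smul (y - x)
  rw [latticeCount_toReal, Nat.add_sub_cancel] at hm
  refine ⟨x, u, ?_, hx, ?_⟩
  · rintro rfl
    exact not_isCoprime_zero_zero hu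
  · rw [latticeDiam, hm]
    have : x + (Int.gcd (y.1 - x.1) (y.2 - x.2) : ℤ) • u = y := by
      rw [eq_comm, ← sub_eq_iff_eq_add', hv]; rfl
    rwa [this]

theorem direction_lineThrough (p v : ℤ × ℤ) :
    (lineThrough (p, p + v)).direction = Submodule.span ℝ {toReal v} := by
  rw [lineThrough, direction_affineSpan, vectorSpan_pair_rev]
  simp [toReal_add]

theorem hasDirection_lineThrough {p v : ℤ × ℤ} {u : ℝ × ℝ}
    (h : Submodule.span ℝ {toReal v} = Submodule.span ℝ {u}) :
    HasDirection (lineThrough (p, p + v)) u := by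
  refine ⟨toReal p, ?_⟩
  rw [← h, ← direction_lineThrough p v]
  exact (AffineSubspace.mk'_eq (left_mem_affineSpan_pair ..)).symm

theorem span_toReal_smul (v : ℤ × ℤ) {k : ℤ} (hk : k ≠ 0) :
    Submodule.span ℝ {toReal (k • v)} = Submodule.span ℝ {toReal v} := by
  rw [toReal_smul]
  exact Submodule.span_singleton_smul_eq (IsUnit.mk0 _ (by exact_mod_cast hk)) _

theorem IsDiameterLine.exists_direction {V : Finset (ℤ × ℤ)}
    (hspan : affineSpan ℝ (hull V) = ⊤) {L : AffineSubspace ℝ (ℝ × ℝ)}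
    (hL : IsDiameterLine (hull V) L) {u : ℝ × ℝ} (hu : HasDirection L u) :
    ∃ x v : ℤ × ℤ, v ≠ 0 ∧ toReal x ∈ hull V ∧
      toReal (x + (latticeDiam (hull V) : ℤ) • v) ∈ hull V ∧
      Submodule.span ℝ {toReal v} = Submodule.span ℝ {u} := by
  obtain ⟨x, y, h, rfl⟩ := hL
  have hcount := h.latticeCount_eq
  obtain ⟨⟨hx, x, rfl⟩, ⟨hy, y, rfl⟩, -⟩ := h
  obtain ⟨v, hv, hvxy⟩ := exists_eq_gcd_smul (y - x)
  rw [latticeCount_toReal, Nat.add_right_cancel_iff] at hcount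
  have hxy : y = x + (latticeDiam (hull V) : ℤ) • v := by
    rw [← sub_eq_iff_eq_add', hvxy, ← hcount]; rfl
  refine ⟨x, v, ?_, hx, hxy ▸ hy, ?_⟩
  · rintro rfl
    exact not_isCoprime_zero_zero hv
  · obtain ⟨z, hz⟩ := hu
    have h1 := one_le_latticeDiam hspan
    have h2 : (affineSpan ℝ {toReal x, toReal y}).direction = Submodule.span ℝ {u} := by
      rw [hz, AffineSubspace.direction_mk']
    have h3 := direction_lineThrough x ((latticeDiam (hull V) : ℤ) • v)
    rw [← hxy, lineThrough, h2, span_toReal_smul v (by omega)] at h3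
    exact h3.symm

/-- The segment from x to x + d v contains at least d + 1 lattice points, which is the maximum.
Since d ≠ 0 it spans the same line as x and x + v. -/
theorem isDiameterLine_lineThrough {V : Finset (ℤ × ℤ)}
    (hspan : affineSpan ℝ (hull V) = ⊤) {x v : ℤ × ℤ} (hv : v ≠ 0) (hx : toReal x ∈ hull V)
    (hy : toReal (x + (latticeDiam (hull V) : ℤ) • v) ∈ hull V) :
    IsDiameterLine (hull V) (lineThrough (x, x + v)) := by
  have h1 := one_le_latticeDiam hspan
  refine ⟨_, _, ⟨⟨hx, x, rfl⟩, ⟨hy, _, rfl⟩, ?_⟩, ?_⟩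
  · intro x' hx' y' hy'
    have h2 : latticeCount x' y' - 1 ≤ latticeDiam (hull V) :=
      le_csSup (bddAbove_latticeDiam V) ⟨_, hx', _, hy', rfl⟩
    have := succ_le_latticeCount hv x (latticeDiam (hull V))
    omega
  · have e1 := direction_lineThrough x v
    have e2 := direction_lineThrough x ((latticeDiam (hull V) : ℤ) • v)
    rw [span_toReal_smul v (by omega), ← e1] at e2
    exact (AffineSubspace.ext_of_direction_eq e2
      ⟨toReal x, left_mem_affineSpan_pair .., left_mem_affineSpan_pair ..⟩).symm

/-- The Krein-Milman theorem. No closure is needed, since there are finitely many extreme points and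
their hull is compact. -/
theorem IsLatticePolygon.eq_hull {P : Set (ℝ × ℝ)} (hP : IsLatticePolygon P)
    {vs : List (ℤ × ℤ)} (hvs : IsVertexList vs P) : P = hull vs.toFinset := by
  obtain ⟨⟨S, hS, rfl⟩, -, -⟩ := hP
  have hset : ((vs.toFinset : Finset (ℤ × ℤ)) : Set (ℤ × ℤ)) = {v | v ∈ vs} := by ext; simp
  have hfin : ((convexHull ℝ S).extremePoints ℝ).Finite :=
    hS.subset extremePoints_convexHull_subset
  have := closure_convexHull_extremePoints (hS.isCompact_convexHull (𝕜 := ℝ)) (convex_convexHull ℝ S)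
  rw [(hfin.isCompact_convexHull (𝕜 := ℝ)).isClosed.closure_eq] at this
  rw [hull, hset, hvs.2, this]

end LatticeDiameter

/-! ### The quadratic form of a maximal triangle and the shortness of diameter directions -/

namespace LatticeDiameter

/-- The bilinear form of the positive definite form `u ↦ (u × e)² + (u × e')²`. -/
def form (e e' u v : ℤ × ℤ) : ℤ := cross u e * cross v e + cross u e' * cross v e'

theorem cross_swap {R : Type*} [CommRing R] (p q : R × R) : cross p q = - cross q p := by
  simp only [cross]; ring

theorem form_comb (e e' u v : ℤ × ℤ) (x y : ℤ) :
    form e e' (x • u + y • v) (x • u + y • v) =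
      form e e' u u * x ^ 2 + 2 * form e e' u v * (x * y) + form e e' v v * y ^ 2 := by
  simp only [form, cross, Prod.fst_add, Prod.snd_add, Prod.smul_fst, Prod.smul_snd, smul_eq_mul]
  ring

/-- Lagrange's identity. It serves to bound the mixed coefficient of the form by the two diagonal
ones. -/
theorem form_gram (e e' u v : ℤ × ℤ) :
    form e e' u u * form e e' v v - form e e' u v ^ 2 = (cross e e' * cross u v) ^ 2 := by
  simp only [form, cross]; ring

theorem form_pos {e e' u : ℤ × ℤ} (h : cross e e' ≠ 0) (hu : u ≠ 0) : 0 < form e e' u u := by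
  by_contra! hn
  simp only [form] at hn
  have h1 : cross u e = 0 := by nlinarith [mul_self_nonneg (cross u e), mul_self_nonneg (cross u e')]
  have h2 : cross u e' = 0 := by nlinarith [mul_self_nonneg (cross u e), mul_self_nonneg (cross u e')]
  have i1 : cross e e' * u.1 = cross u e' * e.1 - cross u e * e'.1 := by simp only [cross]; ring
  have i2 : cross e e' * u.2 = cross u e' * e.2 - cross u e * e'.2 := by simp only [cross]; ring
  rw [h1, h2, zero_mul, zero_mul, sub_zero] at i1 i2
  exact hu (Prod.ext ((mul_eq_zero.1 i1).resolve_left h) ((mul_eq_zero.1 i2).resolve_left h))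

/-- Coefficients of short vectors in a reduced basis are small. -/
theorem abs_coeff_le {a b c x y : ℤ} (ha : 0 < a) (hb : |2 * b| ≤ a) (hc : a ≤ 2 * c)
    (h : a * x ^ 2 + 2 * b * (x * y) + c * y ^ 2 < 64 * a) : |x| ≤ 16 ∧ |y| ≤ 16 := by
  have h1 : |2 * b * (x * y)| ≤ a * (|x| * |y|) := by
    rw [abs_mul, abs_mul x y]
    exact mul_le_mul_of_nonneg_right hb (by positivity)
  have h2 := (abs_le.1 h1).1
  have h3 : a * y ^ 2 ≤ 2 * (c * y ^ 2) := by nlinarith [sq_nonneg y]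
  rw [← sq_abs x] at h
  rw [← sq_abs y] at h h3
  -- Completing squares in 2x² - 2|xy| + y² < 128 in the two possible ways gives x² < 128 and y² <
  -- 256.
  have h4 : a * (2 * |x| ^ 2 - 2 * (|x| * |y|) + |y| ^ 2) < a * 128 := by linarith
  have h5 := lt_of_mul_lt_mul_left h4 ha.le
  constructor
  · nlinarith [sq_nonneg (|x| - |y|), abs_nonneg x]
  · nlinarith [sq_nonneg (2 * |x| - |y|), abs_nonneg y]

/-- The quotient is the integer nearest to b / a, written as a floor. -/
theorem round_reduced {a b : ℤ} (ha : 0 < a) :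
    |2 * (b - (2 * b + a) / (2 * a) * a)| ≤ a := by
  have h1 := Int.emod_add_mul_ediv (2 * b + a) (2 * a)
  have h2 := Int.emod_nonneg (2 * b + a) (show 2 * a ≠ 0 by omega)
  have h3 := Int.emod_lt_of_pos (2 * b + a) (show 0 < 2 * a by omega)
  rw [abs_le]
  constructor <;> linarith

/-- The decrease is m (2b - m a). As m is nearest to b / a, both factors have the same sign, or the
product is 0. -/
theorem round_decreases {a b c : ℤ} (ha : 0 < a) :
    c - 2 * ((2 * b + a) / (2 * a)) * b + ((2 * b + a) / (2 * a)) ^ 2 * a ≤ c := by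
  have h := abs_le.1 (round_reduced (b := b) ha)
  generalize (2 * b + a) / (2 * a) = m at *
  rcases lt_trichotomy m 0 with hm | rfl | hm
  · have : 0 ≤ (-m - 1) * a := mul_nonneg (by omega) ha.le
    have : 0 ≤ m * (2 * b - m * a) := mul_nonneg_of_nonpos_of_nonpos hm.le (by linarith)
    linarith
  · simp
  · have : 0 ≤ (m - 1) * a := mul_nonneg (by omega) ha.le
    have : 0 ≤ m * (2 * b - m * a) := mul_nonneg hm.le (by linarith)
    linarith

/-- Cramer's rule, where a determinant of square 1 is its own inverse. -/
theorem exists_basis_coeff {b₁ b₂ : ℤ × ℤ} (h : cross b₁ b₂ ^ 2 = 1) (v : ℤ × ℤ) :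
    ∃ x y : ℤ, v = x • b₁ + y • b₂ := by
  refine ⟨cross b₁ b₂ * cross v b₂, cross b₁ b₂ * cross b₁ v, ?_⟩
  simp only [cross] at *
  ext
  · simp only [Prod.fst_add, Prod.smul_fst, smul_eq_mul]
    linear_combination (-v.1) * h
  · simp only [Prod.snd_add, Prod.smul_snd, smul_eq_mul]
    linear_combination (-v.2) * h

/-- A triangle of maximal area with vertices in `V`, given by a vertex `w` and edges `e`, `e'`. -/
structure IsMaxTriangle (V : Finset (ℤ × ℤ)) (w e e' : ℤ × ℤ) : Prop where
  mem : w ∈ V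
  mem_add : w + e ∈ V
  mem_add' : w + e' ∈ V
  le : ∀ p ∈ V, ∀ q ∈ V, ∀ r ∈ V, cross (q - p) (r - p) ≤ cross e e'

namespace IsMaxTriangle

variable {V : Finset (ℤ × ℤ)} {w e e' : ℤ × ℤ}

theorem cross_pos (h : IsMaxTriangle V w e e') (hspan : affineSpan ℝ (hull V) = ⊤) :
    0 < cross e e' := by
  obtain ⟨p, hp, -⟩ := exists_cross_ne hspan (u := (1, 0)) (by simp) 0
  obtain ⟨q, hq, hpq⟩ := exists_cross_ne hspan (u := (1, 0)) (by simp) (cross (toReal p) (1, 0))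
  have hne : toReal (q - p) ≠ 0 := by
    intro h0
    rw [← toReal_zero] at h0
    exact hpq (by rw [sub_eq_zero.1 (toReal_injective h0)])
  obtain ⟨r, hr, hrp⟩ := exists_cross_ne hspan hne (cross (toReal p) (toReal (q - p)))
  rw [cross_toReal, cross_toReal, Ne, Int.cast_inj] at hrp
  have h1 := h.le p hp q hq r hr
  have h2 := h.le p hp r hr q hq
  have h3 : cross (r - p) (q - p) = cross r (q - p) - cross p (q - p) := by
    simp only [cross, Prod.fst_sub, Prod.snd_sub]; ring
  rw [cross_swap] at h1
  omega

/-- Maximality is compared with the triangles having the edge e or e' and third vertex p. Both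
orientations are among the ordered triples, which gives the absolute value. -/
theorem abs_cross_sub_le (h : IsMaxTriangle V w e e') {p : ℤ × ℤ} (hp : p ∈ V) :
    (|cross p e - cross w e| ≤ cross e e') ∧ |cross p e' - cross w e'| ≤ cross e e' := by
  have h1 := h.le w h.mem p hp _ h.mem_add
  have h2 := h.le w h.mem _ h.mem_add p hp
  have h3 := h.le w h.mem p hp _ h.mem_add'
  have h4 := h.le w h.mem _ h.mem_add' p hp
  rw [add_sub_cancel_left] at h1 h2 h3 h4
  rw [cross_swap] at h2 h4
  have e1 : ∀ e : ℤ × ℤ, cross (p - w) e = cross p e - cross w e := fun e => by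
    simp only [cross, Prod.fst_sub, Prod.snd_sub]; ring
  rw [e1] at h1 h2 h3 h4
  exact ⟨abs_le.2 ⟨by linarith, h1⟩, abs_le.2 ⟨by linarith, h3⟩⟩

theorem abs_cross_chord_le {f : ℤ × ℤ} {D c : ℤ} (hf : ∀ p ∈ V, |cross p f - c| ≤ D)
    {x v : ℤ × ℤ} {d : ℤ} (hx : toReal x ∈ hull V) (hy : toReal (x + d • v) ∈ hull V) :
    |d * cross v f| ≤ 2 * D := by
  have bound : ∀ z : ℤ × ℤ, toReal z ∈ hull V → |cross z f - c| ≤ D := by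
    intro z hz
    have h1 := cross_convex_le (e := toReal f) (A := (c + D : ℤ)) hz fun p hp => by
      have := abs_le.1 (hf p hp)
      rw [cross_toReal]
      exact_mod_cast (by omega : cross p f ≤ c + D)
    have h2 := cross_convex_le (e := toReal (-f)) (A := (D - c : ℤ)) hz fun p hp => by
      have := abs_le.1 (hf p hp)
      rw [cross_toReal]
      have h3 : cross p (-f) = - cross p f := by simp only [cross, Prod.fst_neg, Prod.snd_neg]; ring
      rw [h3]
      exact_mod_cast (by omega : - cross p f ≤ D - c)
    rw [cross_toReal, Int.cast_le] at h1 h2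
    have h3 : cross z (-f) = - cross z f := by simp only [cross, Prod.fst_neg, Prod.snd_neg]; ring
    rw [h3] at h2
    exact abs_le.2 ⟨by omega, by omega⟩
  have h1 := abs_le.1 (bound x hx)
  have h2 := abs_le.1 (bound _ hy)
  have h3 : cross (x + d • v) f = cross x f + d * cross v f := by
    simp only [cross, Prod.fst_add, Prod.snd_add, Prod.smul_fst, Prod.smul_snd, smul_eq_mul]; ring
  rw [h3] at h2
  exact abs_le.2 ⟨by omega, by omega⟩

/-- Write k u = α e + β e' by Cramer's rule. The hypothesis says |α| + |β| ≤ 1, so the chord from w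
+ α⁻ e + β⁻ e' to w + α⁺ e + β⁺ e' lies in the triangle. Its ends need not be lattice points. -/
theorem exists_chord (h : IsMaxTriangle V w e e') (hD : 0 < cross e e') {u : ℤ × ℤ} {k : ℤ}
    (hk : 0 ≤ k) (hu : k * (|cross u e| + |cross u e'|) ≤ cross e e') :
    ∃ x ∈ hull V, x + (k : ℝ) • toReal u ∈ hull V := by
  have i1 : cross e e' * u.1 = cross u e' * e.1 - cross u e * e'.1 := by simp only [cross]; ring
  have i2 : cross e e' * u.2 = cross u e' * e.2 - cross u e * e'.2 := by simp only [cross]; ring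
  have hconv := convex_convexHull ℝ (toReal '' (V : Set (ℤ × ℤ)))
  have hw : toReal w ∈ hull V := subset_convexHull ℝ _ ⟨w, h.mem, rfl⟩
  have ha : toReal (w + e) ∈ hull V := subset_convexHull ℝ _ ⟨_, h.mem_add, rfl⟩
  have hb : toReal (w + e') ∈ hull V := subset_convexHull ℝ _ ⟨_, h.mem_add', rfl⟩
  have tri : ∀ α β : ℝ, 0 ≤ α → 0 ≤ β → α + β ≤ 1 →
      toReal w + α • toReal e + β • toReal e' ∈ hull V := by
    intro α β hα hβ hαβ
    have := hconv.sum_mem (t := Finset.univ) (w := ![1 - α - β, α, β])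
      (z := ![toReal w, toReal (w + e), toReal (w + e')]) ?_ ?_ ?_
    · convert this using 1
      simp only [Fin.sum_univ_three, Matrix.cons_val_zero, Matrix.cons_val_one, Matrix.cons_val,
        toReal_add]
      module
    · intro i _
      fin_cases i <;> simp <;> linarith
    · simp only [Fin.sum_univ_three, Matrix.cons_val_zero, Matrix.cons_val_one, Matrix.cons_val]
      ring
    · intro i _
      fin_cases i <;> simpa
  generalize hDe : cross e e' = D at *
  generalize cross u e = s at *
  generalize cross u e' = s' at *
  have hD' : (0 : ℝ) < D := by exact_mod_cast hD
  have hk' : (0 : ℝ) ≤ k := by exact_mod_cast hk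
  have i1' : (D : ℝ) * u.1 = s' * e.1 - s * e'.1 := by exact_mod_cast i1
  have i2' : (D : ℝ) * u.2 = s' * e.2 - s * e'.2 := by exact_mod_cast i2
  have hu' : (k : ℝ) * (|(s : ℝ)| + |(s' : ℝ)|) ≤ D := by exact_mod_cast hu
  have hsmul : (k : ℝ) • toReal u = (k * s' / D : ℝ) • toReal e + (-(k * s) / D : ℝ) • toReal e' := by
    have e1 : (u.1 : ℝ) = (s' * e.1 - s * e'.1) / D := by rw [← i1']; field_simp
    have e2 : (u.2 : ℝ) = (s' * e.2 - s * e'.2) / D := by rw [← i2']; field_simp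
    ext
    · simp [toReal, e1]; field_simp; ring
    · simp [toReal, e2]; field_simp; ring
  have hsum : |(k * s' / D : ℝ)| + |(-(k * s) / D : ℝ)| ≤ 1 := by
    rw [abs_div, abs_div, abs_neg, abs_mul, abs_mul, abs_of_nonneg hk', abs_of_pos hD', ← add_div,
      div_le_one hD']
    linarith
  generalize (k * s' / D : ℝ) = α at *
  generalize (-(k * s) / D : ℝ) = β at *
  have n1 := negPart_nonneg α
  have n2 := negPart_nonneg β
  have p1 := posPart_nonneg α
  have p2 := posPart_nonneg β
  have q1 := posPart_add_negPart α
  have q2 := posPart_add_negPart β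
  refine ⟨_, tri α⁻ β⁻ n1 n2 (by linarith), ?_⟩
  have := tri α⁺ β⁺ p1 p2 (by linarith)
  convert this using 1
  rw [hsmul]
  have r1 := posPart_sub_negPart α
  have r2 := posPart_sub_negPart β
  have r1' : α⁺ = α + α⁻ := by linarith
  have r2' : β⁺ = β + β⁻ := by linarith
  rw [r1', r2']
  module

/-- A direction of a lattice diameter line is not much longer than any other lattice vector. -/
theorem form_lt (h : IsMaxTriangle V w e e') (hspan : affineSpan ℝ (hull V) = ⊤)
    {x v : ℤ × ℤ} (hx : toReal x ∈ hull V)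
    (hy : toReal (x + (latticeDiam (hull V) : ℤ) • v) ∈ hull V) {u : ℤ × ℤ} (hu : u ≠ 0) :
    form e e' v v < 64 * form e e' u u := by
  have hD := h.cross_pos hspan
  have hd := one_le_latticeDiam hspan
  have hv := abs_cross_chord_le (fun p hp => (h.abs_cross_sub_le hp).1) hx hy
  have hv' := abs_cross_chord_le (fun p hp => (h.abs_cross_sub_le hp).2) hx hy
  -- Otherwise the triangle contains a chord (d + 1) u. Moved to a vertex, it becomes a lattice
  -- chord longer than the diameter.
  have hlt : cross e e' < ((latticeDiam (hull V) + 1 : ℕ) : ℤ) * (|cross u e| + |cross u e'|) := by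
    by_contra! hle
    obtain ⟨y, hy, hy'⟩ := h.exists_chord hD (by positivity) hle
    obtain ⟨u', hu', p, hp, a, ha, b, hb, h1, h2, h3, h4⟩ :=
      exists_vertex_triple hspan hu hy hy' rfl
    have hu0 : u' ≠ 0 := by
      rcases hu' with rfl | rfl
      · exact hu
      · exact neg_ne_zero.2 hu
    have := le_latticeDiam hu0 (subset_convexHull ℝ _ ⟨p, hp, rfl⟩)
      (add_smul_mem_hull hp ha hb h1 h2 h3 (by positivity) h4)
    omega
  generalize latticeDiam (hull V) = d at *
  simp only [form]
  generalize cross e e' = D at *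
  generalize cross v e = s at *
  generalize cross v e' = s' at *
  have hd' : (1 : ℤ) ≤ d := by exact_mod_cast hd
  push_cast at hlt
  rw [← abs_mul_abs_self (cross u e), ← abs_mul_abs_self (cross u e')]
  have g1 := abs_nonneg (cross u e)
  have g2 := abs_nonneg (cross u e')
  generalize |cross u e| = r at *
  generalize |cross u e'| = r' at *
  have k1 : (d * s) ^ 2 ≤ (2 * D) ^ 2 := sq_le_sq' (abs_le.1 hv).1 (abs_le.1 hv).2
  have k2 : (d * s') ^ 2 ≤ (2 * D) ^ 2 := sq_le_sq' (abs_le.1 hv').1 (abs_le.1 hv').2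
  -- Here d ≥ 1 enters through d + 1 ≤ 2d. The constant 64 then arises as d² Q(v) ≤ 8 D² < 32 d² (r
  -- + r')² ≤ 64 d² (r² + r'²).
  have k3 : D < 2 * d * (r + r') := by nlinarith
  have k4 : D ^ 2 < (2 * d * (r + r')) ^ 2 := by nlinarith
  have k5 : (r + r') ^ 2 ≤ 2 * (r * r + r' * r') := by nlinarith [sq_nonneg (r - r')]
  have k6 : (d : ℤ) ^ 2 * (r + r') ^ 2 ≤ d ^ 2 * (2 * (r * r + r' * r')) :=
    mul_le_mul_of_nonneg_left k5 (sq_nonneg _)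
  have k7 : (d : ℤ) ^ 2 * (s * s + s' * s') < d ^ 2 * (64 * (r * r + r' * r')) := by nlinarith
  exact lt_of_mul_lt_mul_left k7 (sq_nonneg _)

end IsMaxTriangle

end LatticeDiameter

/-! ### Evaluation rules for expressions, programs and states -/

namespace RAM

instance : Add Expr := ⟨.add⟩
instance : Sub Expr := ⟨.sub⟩
instance : Mul Expr := ⟨.mul⟩
instance : Div Expr := ⟨.div⟩

theorem Prog.denote_seq (p q : Prog) (s : State) :
    (Prog.seq p q).denote s = q.denote (p.denote s) := rfl

theorem Prog.denote_skip (s : State) : Prog.skip.denote s = s := rfl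

theorem Prog.denote_assign (x : ℕ) (e : Expr) (s : State) :
    (Prog.assign x e).denote s = s.setVar x (e.eval s) := rfl

theorem Prog.denote_cond_pos {c : Expr} {s : State} (h : 0 < c.eval s) (p q : Prog) :
    (Prog.cond c p q).denote s = p.denote s := if_pos h

theorem Prog.denote_cond_neg {c : Expr} {s : State} (h : ¬ 0 < c.eval s) (p q : Prog) :
    (Prog.cond c p q).denote s = q.denote s := if_neg h

theorem Expr.eval_add (s : State) (e f : Expr) : (e + f).eval s = e.eval s + f.eval s := rfl
theorem Expr.eval_sub (s : State) (e f : Expr) : (e - f).eval s = e.eval s - f.eval s := rfl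
theorem Expr.eval_mul (s : State) (e f : Expr) : (e * f).eval s = e.eval s * f.eval s := rfl
theorem Expr.eval_div (s : State) (e f : Expr) : (e / f).eval s = e.eval s / f.eval s := rfl

/-- The value of a pair of expressions. -/
def evalPair (s : State) (p : Expr × Expr) : ℤ × ℤ := (p.1.eval s, p.2.eval s)

/-- The determinant of two pairs of expressions. -/
def crossExpr (p q : Expr × Expr) : Expr := p.1 * q.2 - p.2 * q.1

theorem eval_crossExpr (s : State) (p q : Expr × Expr) :
    (crossExpr p q).eval s = LatticeDiameter.cross (evalPair s p) (evalPair s q) := rfl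

theorem evalPair_sub (s : State) (p q : Expr × Expr) :
    evalPair s (p - q) = evalPair s p - evalPair s q := rfl

theorem evalPair_add (s : State) (p q : Expr × Expr) :
    evalPair s (p + q) = evalPair s p + evalPair s q := rfl

theorem State.setVar_var (s : State) (x y : ℕ) (z : ℤ) :
    (s.setVar x z).var y = if y = x then z else s.var y := by
  simp [State.setVar, Function.update_apply]

theorem State.setVar_arr (s : State) (x : ℕ) (z : ℤ) : (s.setVar x z).arr = s.arr := rfl

theorem State.setCell_var (s : State) (a : ℕ) (i z : ℤ) : (s.setCell a i z).var = s.var := rfl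

theorem State.setCell_arr_self (s : State) (a : ℕ) (i j z : ℤ) :
    (s.setCell a i z).arr a j = if j = i then z else s.arr a j := by
  simp [State.setCell, Function.update_apply]

theorem State.setCell_arr_of_ne (s : State) {a b : ℕ} (h : b ≠ a) (i z : ℤ) :
    (s.setCell a i z).arr b = s.arr b := by
  simp [State.setCell, h]

end RAM

/-!
## The program

Variables: `0` length of the input, later of the output; `1` loop counter; `2` twice the area of
the triangle with edges `(3, 4)` and `(5, 6)`; `7`, `8`, `9` coefficients of the quadratic form in
the basis `(10, 11)`, `(12, 13)`; `14` lattice diameter; `15` number of lines; `16` quotient in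
the size reduction; `17` number of vertices.
-/

namespace LatticeDiameter.Algorithm

open RAM

/-- The vertex with index `i`. -/
def vertexExpr (i : Expr) : Expr × Expr :=
  (.cell 0 (.const 2 * i), .cell 0 (.const 2 * i + .const 1))

/-- The first vertex of the triple with index `r`. -/
def fstExpr (r : Expr) : Expr × Expr := vertexExpr (r / .var 17 / .var 17)

/-- The second vertex of the triple with index `r`. -/
def sndExpr (r : Expr) : Expr × Expr :=
  vertexExpr (r / .var 17 - .var 17 * (r / .var 17 / .var 17))

/-- The third vertex of the triple with index `r`. -/
def trdExpr (r : Expr) : Expr × Expr := vertexExpr (r - .var 17 * (r / .var 17))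

/-- Twice the signed area of the triangle with index `r`. -/
def areaExpr (r : Expr) : Expr :=
  crossExpr (sndExpr r - fstExpr r) (trdExpr r - fstExpr r)

/-- The number of triples. -/
def cubeExpr : Expr := .var 17 * .var 17 * .var 17

def areaBody : Prog :=
  .seq
    (.cond (areaExpr (.var 1) - .var 2)
      (.seq (.assign 2 (areaExpr (.var 1)))
        (.seq (.assign 3 (sndExpr (.var 1) - fstExpr (.var 1)).1)
          (.seq (.assign 4 (sndExpr (.var 1) - fstExpr (.var 1)).2)
            (.seq (.assign 5 (trdExpr (.var 1) - fstExpr (.var 1)).1)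
              (.assign 6 (trdExpr (.var 1) - fstExpr (.var 1)).2)))))
      .skip)
    (.assign 1 (.var 1 + .const 1))

/-- Size reduction of the second basis vector. -/
def sizeReduce : Prog :=
  .seq (.assign 16 ((.const 2 * .var 8 + .var 7) / (.const 2 * .var 7)))
    (.seq (.assign 9 (.var 9 - .const 2 * .var 16 * .var 8 + .var 16 * .var 16 * .var 7))
      (.seq (.assign 8 (.var 8 - .var 16 * .var 7))
        (.seq (.assign 12 (.var 12 - .var 16 * .var 10))
          (.assign 13 (.var 13 - .var 16 * .var 11)))))

/-- Exchanges two variables. -/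
def swapVars (x y : ℕ) : Prog :=
  .seq (.assign x (.var x + .var y))
    (.seq (.assign y (.var x - .var y)) (.assign x (.var x - .var y)))

/-- One Lagrange-Gauss step. The mixed coefficient is symmetric, so variable 8 takes no part in the
exchange. -/
def gaussBody : Prog :=
  .seq (.seq (swapVars 7 9) (.seq (swapVars 10 12) (swapVars 11 13))) sizeReduce

/-- Starts from the standard basis: (1, 0) × e is the second coordinate of e, and (0, 1) × e is
minus the first. -/
def gaussInit : Prog :=
  .seq (.assign 1 (.const 0))
    (.seq (.assign 7 (.var 4 * .var 4 + .var 6 * .var 6))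
      (.seq (.assign 8 (.const 0 - (.var 4 * .var 3 + .var 6 * .var 5)))
        (.seq (.assign 9 (.var 3 * .var 3 + .var 5 * .var 5))
          (.seq (.assign 10 (.const 1)) (.seq (.assign 11 (.const 0))
            (.seq (.assign 12 (.const 0)) (.seq (.assign 13 (.const 1)) sizeReduce)))))))

/-- The index of the candidate vector. -/
def candIdxExpr : Expr := .var 1 / cubeExpr

/-- The index of the triple of vertices. -/
def triIdxExpr : Expr := .var 1 - cubeExpr * (.var 1 / cubeExpr)

/-- The candidate vector. -/
def candExpr : Expr × Expr :=
  let x := candIdxExpr / .const 33 - .const 16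
  let y := candIdxExpr - .const 33 * (candIdxExpr / .const 33) - .const 16
  (x * .var 10 + y * .var 12, x * .var 11 + y * .var 13)

def sndOffsetExpr : Expr := crossExpr (sndExpr triIdxExpr - fstExpr triIdxExpr) candExpr
def trdOffsetExpr : Expr := crossExpr (trdExpr triIdxExpr - fstExpr triIdxExpr) candExpr

/-- The lattice length of the chord through the first vertex of the triple in the direction of
the candidate. -/
def chordExpr : Expr := areaExpr triIdxExpr / (sndOffsetExpr - trdOffsetExpr)

/-- Appends a line to the output. -/
def appendLine : Prog :=
  .seq (.store 1 (.const 4 * .var 15 + .const 1) (fstExpr triIdxExpr).1)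
    (.seq (.store 1 (.const 4 * .var 15 + .const 2) (fstExpr triIdxExpr).2)
      (.seq (.store 1 (.const 4 * .var 15 + .const 3) (fstExpr triIdxExpr + candExpr).1)
        (.seq (.store 1 (.const 4 * .var 15 + .const 4) (fstExpr triIdxExpr + candExpr).2)
          (.assign 15 (.var 15 + .const 1)))))

/-- Tests are for positivity, so the shifts by 1 express weak inequalities between integers. A
strictly longer chord first discards the list. It then passes the second test, so it is recorded as
well. -/
def chordBody : Prog :=
  .seq
    (.cond (sndOffsetExpr + .const 1)
      (.cond (.const 1 - trdOffsetExpr)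
        (.cond (sndOffsetExpr - trdOffsetExpr)
          (.seq
            (.cond (chordExpr - .var 14) (.seq (.assign 14 chordExpr) (.assign 15 (.const 0))) .skip)
            (.cond (chordExpr - .var 14 + .const 1) appendLine .skip))
          .skip)
        .skip)
      .skip)
    (.assign 1 (.var 1 + .const 1))

def areaLoop : Prog := .loop (cubeExpr - .var 1) areaBody
-- Stops once a ≤ 2c instead of a ≤ c. Each exchange then more than halves the first coefficient,
-- which makes the number of rounds logarithmic.
def gaussLoop : Prog := .loop (.var 7 - .const 2 * .var 9) gaussBody
def chordLoop : Prog := .loop (.const 1089 * cubeExpr - .var 1) chordBody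
def setup : Prog := .assign 17 (.var 0 / .const 2)
def finish : Prog :=
  .seq (.store 1 (.const 0) (.var 14)) (.assign 0 (.const 4 * .var 15 + .const 1))

/-- Computes the lattice diameter of a lattice polygon, and lattice diameter lines of it in all
possible directions. -/
def program : Prog :=
  setup.seq (areaLoop.seq (gaussInit.seq (gaussLoop.seq (chordLoop.seq finish))))

/-! ### Values of the expressions -/

section Values

variable (inp : ℤ → ℤ) (n : ℤ)

/-- The vertex with index `i`. -/
def vertex (i : ℤ) : ℤ × ℤ := (inp (2 * i), inp (2 * i + 1))

/-- The first vertex of the triple with index `r`. -/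
def triFst (r : ℤ) : ℤ × ℤ := vertex inp (r / n / n)

/-- The second vertex of the triple with index `r`. -/
def triSnd (r : ℤ) : ℤ × ℤ := vertex inp (r / n - n * (r / n / n))

/-- The third vertex of the triple with index `r`. -/
def triTrd (r : ℤ) : ℤ × ℤ := vertex inp (r - n * (r / n))

/-- Twice the signed area of the triangle with index `r`. -/
def triArea (r : ℤ) : ℤ :=
  cross (triSnd inp n r - triFst inp n r) (triTrd inp n r - triFst inp n r)

/-- The index of the triple of vertices in step `j`. -/
def triIdx (j : ℤ) : ℤ := j - n * n * n * (j / (n * n * n))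

/-- The candidate vector in step `j`. -/
def cand (b b' : ℤ × ℤ) (j : ℤ) : ℤ × ℤ :=
  (j / (n * n * n) / 33 - 16) • b + (j / (n * n * n) - 33 * (j / (n * n * n) / 33) - 16) • b'

def sndOffset (b b' : ℤ × ℤ) (j : ℤ) : ℤ :=
  cross (triSnd inp n (triIdx n j) - triFst inp n (triIdx n j)) (cand n b b' j)

def trdOffset (b b' : ℤ × ℤ) (j : ℤ) : ℤ :=
  cross (triTrd inp n (triIdx n j) - triFst inp n (triIdx n j)) (cand n b b' j)

/-- The lattice length of the chord of step `j`. -/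
def chord (b b' : ℤ × ℤ) (j : ℤ) : ℤ :=
  triArea inp n (triIdx n j) / (sndOffset inp n b b' j - trdOffset inp n b b' j)

/-- The ray of step `j` meets the edge of the triangle opposite to its first vertex. -/
def Valid (b b' : ℤ × ℤ) (j : ℤ) : Prop :=
  0 ≤ sndOffset inp n b b' j ∧ trdOffset inp n b b' j ≤ 0 ∧
    trdOffset inp n b b' j < sndOffset inp n b b' j

/-- The line of step `j`. -/
def candLine (b b' : ℤ × ℤ) (j : ℤ) : (ℤ × ℤ) × (ℤ × ℤ) :=
  (triFst inp n (triIdx n j), triFst inp n (triIdx n j) + cand n b b' j)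

end Values

/-- The part of the state that is only read while the chords are computed. -/
structure View (s : State) (inp : ℤ → ℤ) (n : ℤ) (b b' : ℤ × ℤ) (j : ℤ) : Prop where
  arr : s.arr 0 = inp
  count : s.var 17 = n
  counter : s.var 1 = j
  fst : (s.var 10, s.var 11) = b
  snd : (s.var 12, s.var 13) = b'

namespace View

variable {s : State} {inp : ℤ → ℤ} {n : ℤ} {b b' : ℤ × ℤ} {j : ℤ}

theorem setVar (h : View s inp n b b' j) {x : ℕ} (hx : x ∉ [1, 10, 11, 12, 13, 17]) (z : ℤ) :
    View (s.setVar x z) inp n b b' j := by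
  simp only [List.mem_cons, List.not_mem_nil, or_false, not_or] at hx
  obtain ⟨h1, h2, h3, h4, h5, h6⟩ := hx
  constructor <;>
    simp only [State.setVar_arr, State.setVar_var, Ne.symm h1, Ne.symm h2, Ne.symm h3,
      Ne.symm h4, Ne.symm h5, Ne.symm h6, if_false, h.arr, h.count, h.counter, h.fst, h.snd]

theorem setCell (h : View s inp n b b' j) (i z : ℤ) :
    View (s.setCell 1 i z) inp n b b' j :=
  ⟨(s.setCell_arr_of_ne (by decide) i z).trans h.arr, h.count, h.counter, h.fst, h.snd⟩

theorem eval_triIdx (h : View s inp n b b' j) : triIdxExpr.eval s = triIdx n j := by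
  simp only [triIdxExpr, cubeExpr, Expr.eval_sub, Expr.eval_div, Expr.eval,
    h.count, h.counter, triIdx]

theorem eval_fst (h : View s inp n b b' j) (r : Expr) :
    evalPair s (fstExpr r) = triFst inp n (r.eval s) := by
  simp only [evalPair, fstExpr, vertexExpr, Expr.eval_div, Expr.eval,
    h.count, h.arr, triFst, vertex]

theorem eval_snd (h : View s inp n b b' j) (r : Expr) :
    evalPair s (sndExpr r) = triSnd inp n (r.eval s) := by
  simp only [evalPair, sndExpr, vertexExpr, Expr.eval_sub, Expr.eval_div,
    Expr.eval, h.count, h.arr, triSnd, vertex]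

theorem eval_trd (h : View s inp n b b' j) (r : Expr) :
    evalPair s (trdExpr r) = triTrd inp n (r.eval s) := by
  simp only [evalPair, trdExpr, vertexExpr, Expr.eval_sub, Expr.eval_div,
    Expr.eval, h.count, h.arr, triTrd, vertex]

theorem eval_area (h : View s inp n b b' j) (r : Expr) :
    (areaExpr r).eval s = triArea inp n (r.eval s) := by
  simp only [areaExpr, eval_crossExpr, evalPair_sub, h.eval_fst, h.eval_snd, h.eval_trd, triArea]

theorem eval_cand (h : View s inp n b b' j) : evalPair s candExpr = cand n b b' j := by
  obtain ⟨h1, h2, h3, rfl, rfl⟩ := h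
  simp only [evalPair, candExpr, candIdxExpr, cubeExpr, Expr.eval_add, Expr.eval_sub,
    Expr.eval_div, Expr.eval, h2, h3, cand]
  rfl

theorem eval_sndOffset (h : View s inp n b b' j) :
    sndOffsetExpr.eval s = sndOffset inp n b b' j := by
  simp only [sndOffsetExpr, eval_crossExpr, evalPair_sub, h.eval_fst, h.eval_snd, h.eval_cand,
    h.eval_triIdx, sndOffset]

theorem eval_trdOffset (h : View s inp n b b' j) :
    trdOffsetExpr.eval s = trdOffset inp n b b' j := by
  simp only [trdOffsetExpr, eval_crossExpr, evalPair_sub, h.eval_fst, h.eval_trd, h.eval_cand,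
    h.eval_triIdx, trdOffset]

theorem eval_chord (h : View s inp n b b' j) : chordExpr.eval s = chord inp n b b' j := by
  simp only [chordExpr, Expr.eval_div, Expr.eval_sub, h.eval_area, h.eval_triIdx,
    h.eval_sndOffset, h.eval_trdOffset, chord]

theorem eval_line (h : View s inp n b b' j) :
    (evalPair s (fstExpr triIdxExpr), evalPair s (fstExpr triIdxExpr + candExpr)) =
      candLine inp n b b' j := by
  rw [evalPair_add, h.eval_fst, h.eval_triIdx, h.eval_cand, candLine]

end View

/-- The numbers `d` and `lines` are stored as the output so far. -/
structure Stored (s : State) (d : ℤ) (lines : List ((ℤ × ℤ) × (ℤ × ℤ))) : Prop where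
  diam : s.var 14 = d
  length : s.var 15 = lines.length
  cells : ∀ i : ℕ, i < 4 * lines.length → s.arr 1 (i + 1) =
    (lines.flatMap fun l => [l.1.1, l.1.2, l.2.1, l.2.2]).getD i 0

theorem length_encodeLines (lines : List ((ℤ × ℤ) × (ℤ × ℤ))) :
    (lines.flatMap fun l => [l.1.1, l.1.2, l.2.1, l.2.2]).length = 4 * lines.length := by
  induction lines with
  | nil => rfl
  | cons l ls ih => simp only [List.flatMap_cons, List.length_append, ih, List.length_cons,
      List.length_nil]; ring

theorem Stored.reset (s : State) (k : ℤ) : Stored ((s.setVar 14 k).setVar 15 0) k [] :=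
  ⟨by simp [State.setVar_var], by simp [State.setVar_var], fun i hi => by simp at hi⟩

section Append

variable {s : State} {inp : ℤ → ℤ} {n : ℤ} {b b' : ℤ × ℤ} {j : ℤ}

/-- The expressions read array 0 and are evaluated anew after each store. The stores go to array 1,
so `View` persists and the values do not change. -/
theorem denote_appendLine (h : View s inp n b b' j) :
    appendLine.denote s =
      ((((s.setCell 1 (4 * s.var 15 + 1) (candLine inp n b b' j).1.1).setCell 1
        (4 * s.var 15 + 2) (candLine inp n b b' j).1.2).setCell 1
        (4 * s.var 15 + 3) (candLine inp n b b' j).2.1).setCell 1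
        (4 * s.var 15 + 4) (candLine inp n b b' j).2.2).setVar 15 (s.var 15 + 1) := by
  have e1 : ∀ t, View t inp n b b' j → (fstExpr triIdxExpr).1.eval t =
      (candLine inp n b b' j).1.1 := fun t ht => by rw [← ht.eval_line]; rfl
  have e2 : ∀ t, View t inp n b b' j → (fstExpr triIdxExpr).2.eval t =
      (candLine inp n b b' j).1.2 := fun t ht => by rw [← ht.eval_line]; rfl
  have e3 : ∀ t, View t inp n b b' j → (fstExpr triIdxExpr + candExpr).1.eval t =
      (candLine inp n b b' j).2.1 := fun t ht => by rw [← ht.eval_line]; rfl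
  have e4 : ∀ t, View t inp n b b' j → (fstExpr triIdxExpr + candExpr).2.eval t =
      (candLine inp n b b' j).2.2 := fun t ht => by rw [← ht.eval_line]; rfl
  simp only [appendLine, Prog.denote]
  rw [e1 s h]
  rw [e2 _ (h.setCell _ _)]
  rw [e3 _ ((h.setCell _ _).setCell _ _)]
  rw [e4 _ (((h.setCell _ _).setCell _ _).setCell _ _)]
  rfl

theorem Stored.append {d : ℤ} {lines : List ((ℤ × ℤ) × (ℤ × ℤ))} (hs : Stored s d lines)
    (h : View s inp n b b' j) :
    Stored (appendLine.denote s) d (lines ++ [candLine inp n b b' j]) := by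
  rw [denote_appendLine h]
  constructor
  · simp [State.setVar_var, State.setCell_var, hs.diam]
  · simp [State.setVar_var, hs.length]
  · intro i hi
    simp only [State.setVar_arr, State.setCell_arr_self, hs.length, List.flatMap_append,
      List.flatMap_cons, List.flatMap_nil, List.append_nil]
    rw [List.length_append, List.length_singleton] at hi
    by_cases hlt : i < 4 * lines.length
    · rw [List.getD_append _ _ _ _ (by rw [length_encodeLines]; exact hlt), ← hs.cells i hlt]
      rw [if_neg (by omega), if_neg (by omega), if_neg (by omega), if_neg (by omega)]
    · rw [List.getD_append_right _ _ _ _ (by rw [length_encodeLines]; omega), length_encodeLines]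
      obtain ⟨m, rfl⟩ : ∃ m, i = 4 * lines.length + m := ⟨i - 4 * lines.length, by omega⟩
      have hm : m < 4 := by omega
      rw [Nat.add_sub_cancel_left]
      push_cast
      interval_cases m
      · rw [if_neg (by omega), if_neg (by omega), if_neg (by omega), if_pos (by omega)]; rfl
      · rw [if_neg (by omega), if_neg (by omega), if_pos (by omega)]; rfl
      · rw [if_neg (by omega), if_pos (by omega)]; rfl
      · rw [if_pos (by omega)]; rfl

theorem view_appendLine (h : View s inp n b b' j) :
    View (appendLine.denote s) inp n b b' j := by
  rw [denote_appendLine h]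
  exact ((((h.setCell _ _).setCell _ _).setCell _ _).setCell _ _).setVar (by decide) _

theorem bounded_appendLine {L : ℕ} (hb : s.Bounded L) (h : View s inp n b b' j)
    (hl : |(candLine inp n b b' j).1.1| ≤ 2 ^ L ∧ |(candLine inp n b b' j).1.2| ≤ 2 ^ L ∧
      |(candLine inp n b b' j).2.1| ≤ 2 ^ L ∧ |(candLine inp n b b' j).2.2| ≤ 2 ^ L)
    (hc : |s.var 15 + 1| ≤ 2 ^ L) : (appendLine.denote s).Bounded L := by
  rw [denote_appendLine h]
  exact ((((hb.setCell _ _ hl.1).setCell _ _ hl.2.1).setCell _ _ hl.2.2.1).setCell _ _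
    hl.2.2.2).setVar _ hc

end Append

end LatticeDiameter.Algorithm

/-! ### Enumeration of triples, size bounds, and the first two loops -/

namespace LatticeDiameter.Algorithm

open RAM

/-- The input of the program lists the vertices of a polygon, whose coordinates are at most `c`,
and `2 ^ L` bounds all numbers in the run. -/
structure InputData (V : Finset (ℤ × ℤ)) (inp : ℤ → ℤ) (n c : ℤ) (L : ℕ) : Prop where
  span : affineSpan ℝ (hull V) = ⊤
  vertex_mem : ∀ i, 0 ≤ i → i < n → vertex inp i ∈ V
  exists_vertex : ∀ p ∈ V, ∃ i, 0 ≤ i ∧ i < n ∧ vertex inp i = p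
  coord : ∀ p ∈ V, |p.1| ≤ c ∧ |p.2| ≤ c
  one_le_coord : 1 ≤ c
  one_le_count : 1 ≤ n
  one_le_log : 1 ≤ L
  cube_le : 1089 * (n * n * n) ≤ 2 ^ L
  coord_le : 4096 * c ^ 3 ≤ 2 ^ L

namespace InputData

variable {V : Finset (ℤ × ℤ)} {inp : ℤ → ℤ} {n c : ℤ} {L : ℕ}

/-- The three vertex indices are the base n digits of r. `exists_tri` is the converse direction. -/
theorem tri_mem (h : InputData V inp n c L) {r : ℤ} (h0 : 0 ≤ r) (h1 : r < n * n * n) :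
    triFst inp n r ∈ V ∧ triSnd inp n r ∈ V ∧ triTrd inp n r ∈ V := by
  have hn : 0 < n := h.one_le_count
  have e : ∀ x : ℤ, x - n * (x / n) = x % n := fun x => (Int.emod_def x n).symm
  have m : ∀ x : ℤ, vertex inp (x % n) ∈ V := fun x =>
    h.vertex_mem _ (Int.emod_nonneg x hn.ne') (Int.emod_lt_of_pos x hn)
  refine ⟨h.vertex_mem _ ?_ ?_, ?_, ?_⟩
  · exact Int.ediv_nonneg (Int.ediv_nonneg h0 hn.le) hn.le
  · exact Int.ediv_lt_of_lt_mul hn (Int.ediv_lt_of_lt_mul hn h1)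
  · rw [triSnd, e]; exact m _
  · rw [triTrd, e]; exact m _

theorem exists_tri (h : InputData V inp n c L) {p q r : ℤ × ℤ} (hp : p ∈ V) (hq : q ∈ V)
    (hr : r ∈ V) : ∃ i, 0 ≤ i ∧ i < n * n * n ∧ triFst inp n i = p ∧ triSnd inp n i = q ∧
      triTrd inp n i = r := by
  have hn : 0 < n := h.one_le_count
  obtain ⟨i, hi0, hi1, rfl⟩ := h.exists_vertex p hp
  obtain ⟨j, hj0, hj1, rfl⟩ := h.exists_vertex q hq
  obtain ⟨k, hk0, hk1, rfl⟩ := h.exists_vertex r hr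
  have e1 : ((i * n + j) * n + k) / n = i * n + j := by
    rw [add_comm, Int.add_mul_ediv_right _ _ hn.ne', Int.ediv_eq_zero_of_lt hk0 hk1, zero_add]
  have e2 : (i * n + j) / n = i := by
    rw [add_comm, Int.add_mul_ediv_right _ _ hn.ne', Int.ediv_eq_zero_of_lt hj0 hj1, zero_add]
  refine ⟨(i * n + j) * n + k, by positivity, ?_, ?_, ?_, ?_⟩
  · have h1 : i * n + j < n * n := by nlinarith
    nlinarith
  · rw [triFst, e1, e2]
  · rw [triSnd, e1, e2]; congr 1; ring
  · rw [triTrd, e1]; congr 1; ring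

theorem cube_pos (h : InputData V inp n c L) : 0 < n * n * n := by
  have := h.one_le_count
  positivity

theorem triIdx_nonneg (h : InputData V inp n c L) (j : ℤ) : 0 ≤ triIdx n j := by
  rw [triIdx, ← Int.emod_def]
  exact Int.emod_nonneg _ h.cube_pos.ne'

theorem triIdx_lt (h : InputData V inp n c L) (j : ℤ) : triIdx n j < n * n * n := by
  rw [triIdx, ← Int.emod_def]
  exact Int.emod_lt_of_pos _ h.cube_pos

theorem coord_sub (h : InputData V inp n c L) {p q : ℤ × ℤ} (hp : p ∈ V) (hq : q ∈ V) :
    |(p - q).1| ≤ 2 * c ∧ |(p - q).2| ≤ 2 * c := by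
  have h1 := h.coord p hp
  have h2 := h.coord q hq
  simp only [abs_le, Prod.fst_sub, Prod.snd_sub] at *
  omega

theorem abs_cross_le {p q : ℤ × ℤ} {A B : ℤ} (hp : |p.1| ≤ A ∧ |p.2| ≤ A)
    (hq : |q.1| ≤ B ∧ |q.2| ≤ B) : |cross p q| ≤ 2 * (A * B) := by
  have h1 : |p.1 * q.2| ≤ A * B := by
    rw [abs_mul]; exact mul_le_mul hp.1 hq.2 (abs_nonneg _) ((abs_nonneg _).trans hp.1)
  have h2 : |p.2 * q.1| ≤ A * B := by
    rw [abs_mul]; exact mul_le_mul hp.2 hq.1 (abs_nonneg _) ((abs_nonneg _).trans hp.2)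
  have := abs_sub (p.1 * q.2) (p.2 * q.1)
  rw [cross]
  linarith

theorem abs_triArea_le (h : InputData V inp n c L) {r : ℤ} (h0 : 0 ≤ r) (h1 : r < n * n * n) :
    |triArea inp n r| ≤ 8 * c ^ 2 := by
  obtain ⟨hp, hq, hr⟩ := h.tri_mem h0 h1
  refine (abs_cross_le (h.coord_sub hq hp) (h.coord_sub hr hp)).trans (le_of_eq ?_)
  ring

theorem le_of_le_coord (h : InputData V inp n c L) {z : ℤ} (hz : z ≤ 4096 * c) : z ≤ 2 ^ L := by
  have := h.one_le_coord
  have h1 : c ≤ c ^ 3 := le_self_pow₀ this (by norm_num)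
  linarith [h.coord_le]

theorem le_of_le_sq (h : InputData V inp n c L) {z : ℤ} (hz : z ≤ 4096 * c ^ 2) : z ≤ 2 ^ L := by
  have := h.one_le_coord
  have h1 : c ^ 2 ≤ c ^ 3 := pow_le_pow_right₀ this (by norm_num)
  linarith [h.coord_le]

theorem le_of_le_cube (h : InputData V inp n c L) {z : ℤ} (hz : z ≤ 4096 * c ^ 3) : z ≤ 2 ^ L :=
  hz.trans h.coord_le

end InputData

/-! ### The loop that finds a triangle of maximal area -/

section Area

variable {V : Finset (ℤ × ℤ)} {inp : ℤ → ℤ} {n c : ℤ} {L : ℕ}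

/-- Only the edges are stored, so the base vertex is merely asserted to exist. The zero edges
present at the start satisfy this with any vertex. The fields `diam` and `lines` carry the initial
zeros on to the search loop. -/
structure AreaInv (V : Finset (ℤ × ℤ)) (inp : ℤ → ℤ) (n : ℤ) (L k : ℕ) (s : State) : Prop where
  bounded : s.Bounded L
  arr : s.arr 0 = inp
  count : s.var 17 = n
  diam : s.var 14 = 0
  lines : s.var 15 = 0
  counter_nonneg : 0 ≤ s.var 1
  remaining : (k : ℤ) = n * n * n - s.var 1
  area : s.var 2 = cross (s.var 3, s.var 4) (s.var 5, s.var 6)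
  area_nonneg : 0 ≤ s.var 2
  mem : ∃ w ∈ V, w + (s.var 3, s.var 4) ∈ V ∧ w + (s.var 5, s.var 6) ∈ V
  le_area : ∀ r, 0 ≤ r → r < s.var 1 → triArea inp n r ≤ s.var 2

theorem AreaInv.step (hin : InputData V inp n c L) {k : ℕ} {s : State} (h : AreaInv V inp n L k s)
    (hpos : 0 < (cubeExpr - .var 1).eval s) : ∃ k' < k, AreaInv V inp n L k' (areaBody.denote s) := by
  have hj : s.var 1 < n * n * n := by
    have : (cubeExpr - .var 1).eval s = s.var 17 * s.var 17 * s.var 17 - s.var 1 := rfl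
    rw [this, h.count] at hpos
    omega
  have hk : 1 ≤ k := by have := h.remaining; omega
  have hview : View s inp n (s.var 10, s.var 11) (s.var 12, s.var 13) (s.var 1) :=
    ⟨h.arr, h.count, rfl, rfl, rfl⟩
  obtain ⟨hp, hq, hr⟩ := hin.tri_mem h.counter_nonneg hj
  have hjB : |s.var 1 + 1| ≤ 2 ^ L := by
    have := h.counter_nonneg
    have := hin.cube_le
    have := hin.cube_pos
    rw [abs_of_nonneg (by omega)]; omega
  refine ⟨k - 1, by omega, ?_⟩
  by_cases hA : 0 < triArea inp n (s.var 1) - s.var 2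
  · have e2 : ∀ t, View t inp n (s.var 10, s.var 11) (s.var 12, s.var 13) (s.var 1) →
        evalPair t (sndExpr (.var 1) - fstExpr (.var 1)) =
          triSnd inp n (s.var 1) - triFst inp n (s.var 1) := fun t ht => by
      rw [evalPair_sub, ht.eval_snd, ht.eval_fst]; simp only [Expr.eval, ht.counter]
    have e3 : ∀ t, View t inp n (s.var 10, s.var 11) (s.var 12, s.var 13) (s.var 1) →
        evalPair t (trdExpr (.var 1) - fstExpr (.var 1)) =
          triTrd inp n (s.var 1) - triFst inp n (s.var 1) := fun t ht => by
      rw [evalPair_sub, ht.eval_trd, ht.eval_fst]; simp only [Expr.eval, ht.counter]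
    have hden : areaBody.denote s =
        (((((s.setVar 2 (triArea inp n (s.var 1))).setVar 3
          (triSnd inp n (s.var 1) - triFst inp n (s.var 1)).1).setVar 4
          (triSnd inp n (s.var 1) - triFst inp n (s.var 1)).2).setVar 5
          (triTrd inp n (s.var 1) - triFst inp n (s.var 1)).1).setVar 6
          (triTrd inp n (s.var 1) - triFst inp n (s.var 1)).2).setVar 1 (s.var 1 + 1) := by
      have hcond : 0 < (areaExpr (.var 1) - .var 2).eval s := by
        rw [Expr.eval_sub, hview.eval_area]; exact hA
      have f1 : (areaExpr (.var 1)).eval s = triArea inp n (s.var 1) := hview.eval_area _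
      have v2 := hview.setVar (x := 2) (by decide) (triArea inp n (s.var 1))
      have v3 := v2.setVar (x := 3) (by decide) (triSnd inp n (s.var 1) - triFst inp n (s.var 1)).1
      have v4 := v3.setVar (x := 4) (by decide) (triSnd inp n (s.var 1) - triFst inp n (s.var 1)).2
      have v5 := v4.setVar (x := 5) (by decide) (triTrd inp n (s.var 1) - triFst inp n (s.var 1)).1
      have f2 := congrArg Prod.fst (e2 _ v2)
      have f3 := congrArg Prod.snd (e2 _ v3)
      have f4 := congrArg Prod.fst (e3 _ v4)
      have f5 := congrArg Prod.snd (e3 _ v5)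
      simp only [evalPair] at f2 f3 f4 f5
      rw [areaBody, Prog.denote_seq, Prog.denote_cond_pos hcond]
      simp only [Prog.denote_seq, Prog.denote_assign]
      rw [f1, f2, f3, f4, f5]
      rfl
    rw [hden]
    have c1 := hin.coord_sub hq hp
    have c2 := hin.coord_sub hr hp
    have hc := hin.one_le_coord
    have hsmall : ∀ z : ℤ, |z| ≤ 2 * c → |z| ≤ 2 ^ L := fun z hz =>
      hin.le_of_le_coord (by linarith)
    refine ⟨?_, h.arr, ?_, ?_, ?_, ?_, ?_, ?_, ?_, ⟨_, hp, ?_, ?_⟩, ?_⟩ <;>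
      try simp only [State.setVar_var, Nat.reduceEqDiff, if_false, if_true, OfNat.ofNat_ne_one,
        OfNat.one_ne_ofNat]
    · refine (((((h.bounded.setVar 2 ?_).setVar 3 (hsmall _ c1.1)).setVar 4
        (hsmall _ c1.2)).setVar 5 (hsmall _ c2.1)).setVar 6 (hsmall _ c2.2)).setVar 1 hjB
      refine hin.le_of_le_sq ((hin.abs_triArea_le h.counter_nonneg hj).trans ?_)
      nlinarith
    · exact h.count
    · exact h.diam
    · exact h.lines
    · linarith [h.counter_nonneg]
    · have := h.remaining
      push_cast [hk]
      linarith
    · rfl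
    · linarith [h.area_nonneg]
    · change triFst inp n (s.var 1) + (triSnd inp n (s.var 1) - triFst inp n (s.var 1)) ∈ V
      rwa [add_sub_cancel]
    · change triFst inp n (s.var 1) + (triTrd inp n (s.var 1) - triFst inp n (s.var 1)) ∈ V
      rwa [add_sub_cancel]
    · intro r hr0 hr1
      rcases (Int.lt_add_one_iff.1 hr1).lt_or_eq with hlt | rfl
      · linarith [h.le_area r hr0 hlt]
      · exact le_rfl
  · have hden : areaBody.denote s = s.setVar 1 (s.var 1 + 1) := by
      have hcond : ¬ 0 < (areaExpr (.var 1) - .var 2).eval s := by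
        rw [Expr.eval_sub, hview.eval_area]; exact hA
      rw [areaBody, Prog.denote_seq, Prog.denote_cond_neg hcond]
      rfl
    rw [hden]
    refine ⟨h.bounded.setVar 1 hjB, h.arr, ?_, ?_, ?_, ?_, ?_, ?_, ?_, ?_, ?_⟩ <;>
      try simp only [State.setVar_var, if_false, if_true, OfNat.ofNat_ne_one]
    · exact h.count
    · exact h.diam
    · exact h.lines
    · linarith [h.counter_nonneg]
    · have := h.remaining
      push_cast [hk]
      linarith
    · exact h.area
    · exact h.area_nonneg
    · exact h.mem
    · intro r hr0 hr1
      rcases (Int.lt_add_one_iff.1 hr1).lt_or_eq with hlt | rfl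
      · exact h.le_area r hr0 hlt
      · linarith

theorem AreaInv.isMaxTriangle (hin : InputData V inp n c L) {k : ℕ} {s : State}
    (h : AreaInv V inp n L k s) (hpos : ¬ 0 < (cubeExpr - .var 1).eval s) :
    ∃ w, IsMaxTriangle V w (s.var 3, s.var 4) (s.var 5, s.var 6) := by
  have hj : n * n * n ≤ s.var 1 := by
    have : (cubeExpr - .var 1).eval s = s.var 17 * s.var 17 * s.var 17 - s.var 1 := rfl
    rw [this, h.count] at hpos
    omega
  obtain ⟨w, h1, h2, h3⟩ := h.mem
  refine ⟨w, h1, h2, h3, fun p hp q hq r hr => ?_⟩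
  obtain ⟨i, hi0, hi1, rfl, rfl, rfl⟩ := hin.exists_tri hp hq hr
  rw [← h.area]
  exact h.le_area i hi0 (by omega)

end Area

/-! ### The loop that computes a reduced basis -/

section Gauss

variable {V : Finset (ℤ × ℤ)} {inp : ℤ → ℤ} {n c : ℤ} {L : ℕ} {w e e' : ℤ × ℤ}

/-- Since |z| ≤ z² for integers, both determinants of u are at most B. Cramer's rule then bounds D
u, and D ≥ 1. -/
theorem abs_coord_le_of_form_le {u : ℤ × ℤ} {A B : ℤ} (hD : 0 < cross e e')
    (he : |e.1| ≤ A ∧ |e.2| ≤ A) (he' : |e'.1| ≤ A ∧ |e'.2| ≤ A) (hu : form e e' u u ≤ B) :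
    |u.1| ≤ 2 * (B * A) ∧ |u.2| ≤ 2 * (B * A) := by
  have hx : ∀ z : ℤ, |z| ≤ z * z := fun z => by
    rw [← abs_mul_abs_self z]
    nlinarith [abs_nonneg z, Int.le_self_sq |z|]
  have h1 : |cross u e| ≤ B := by
    have := hx (cross u e)
    have := mul_self_nonneg (cross u e')
    simp only [form] at hu
    linarith
  have h2 : |cross u e'| ≤ B := by
    have := hx (cross u e')
    have := mul_self_nonneg (cross u e)
    simp only [form] at hu
    linarith
  have i1 : cross e e' * u.1 = cross u e' * e.1 - cross u e * e'.1 := by simp only [cross]; ring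
  have i2 : cross e e' * u.2 = cross u e' * e.2 - cross u e * e'.2 := by simp only [cross]; ring
  have hB : 0 ≤ B := (abs_nonneg _).trans h1
  have key : ∀ x y z : ℤ, cross e e' * z = cross u e' * x - cross u e * y → |x| ≤ A → |y| ≤ A →
      |z| ≤ 2 * (B * A) := by
    intro x y z hz hx hy
    have k1 : |z| ≤ |cross e e' * z| := by
      rw [abs_mul, abs_of_pos hD]
      nlinarith [abs_nonneg z]
    have k2 : |cross u e' * x| ≤ B * A := by
      rw [abs_mul]; exact mul_le_mul h2 hx (abs_nonneg _) hB
    have k3 : |cross u e * y| ≤ B * A := by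
      rw [abs_mul]; exact mul_le_mul h1 hy (abs_nonneg _) hB
    have k4 := abs_sub (cross u e' * x) (cross u e * y)
    rw [hz] at k1
    linarith
  exact ⟨key _ _ _ i1 he.1 he'.1, key _ _ _ i2 he.2 he'.2⟩

/-- The state holds a lattice basis and the coefficients of the form in this basis. -/
structure BasisInv (inp : ℤ → ℤ) (n c : ℤ) (L : ℕ) (e e' : ℤ × ℤ) (s : State) : Prop where
  bounded : s.Bounded L
  arr : s.arr 0 = inp
  count : s.var 17 = n
  diam : s.var 14 = 0
  lines : s.var 15 = 0
  counter : s.var 1 = 0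
  fst : s.var 7 = form e e' (s.var 10, s.var 11) (s.var 10, s.var 11)
  mixed : s.var 8 = form e e' (s.var 10, s.var 11) (s.var 12, s.var 13)
  snd : s.var 9 = form e e' (s.var 12, s.var 13) (s.var 12, s.var 13)
  det : cross (s.var 10, s.var 11) (s.var 12, s.var 13) ^ 2 = 1
  fst_le : s.var 7 ≤ 8 * c ^ 2
  snd_le : s.var 9 ≤ 8 * c ^ 2

theorem BasisInv.fst_ne_zero {s : State} (h : BasisInv inp n c L e e' s) :
    ((s.var 10, s.var 11) : ℤ × ℤ) ≠ 0 := by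
  intro h0
  have := h.det
  rw [h0] at this
  simp [cross] at this

theorem BasisInv.snd_ne_zero {s : State} (h : BasisInv inp n c L e e' s) :
    ((s.var 12, s.var 13) : ℤ × ℤ) ≠ 0 := by
  intro h0
  have := h.det
  rw [h0] at this
  simp [cross] at this

theorem denote_swapVars {x y : ℕ} (hxy : x ≠ y) (s : State) :
    (∀ z, ((swapVars x y).denote s).var z =
      if z = x then s.var y else if z = y then s.var x else s.var z) ∧
    ((swapVars x y).denote s).arr = s.arr := by
  refine ⟨fun z => ?_, rfl⟩
  simp only [swapVars, Prog.denote, Expr.eval_sub, Expr.eval, State.setVar_var,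
    if_true, if_neg hxy, if_neg hxy.symm]
  split_ifs <;> ring

/-- The intermediate sum may exceed 2 ^ L, so the bound is read off from the final values and not
carried through the assignments. -/
theorem bounded_swapVars {x y : ℕ} (hxy : x ≠ y) {s : State} (h : s.Bounded L) :
    ((swapVars x y).denote s).Bounded L := by
  obtain ⟨h1, h2⟩ := denote_swapVars hxy s
  refine ⟨fun z => ?_, fun a i => by rw [h2]; exact h.2 a i⟩
  rw [h1]
  split_ifs <;> exact h.1 _

/-- The exchange reverses the orientation, which is why the invariant only fixes the square of the
determinant. -/
theorem BasisInv.swap {s : State} (h : BasisInv inp n c L e e' s) :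
    let s' := (Prog.seq (swapVars 7 9) (.seq (swapVars 10 12) (swapVars 11 13))).denote s
    BasisInv inp n c L e e' s' ∧ s'.var 7 = s.var 9 := by
  simp only [Prog.denote]
  have b1 := bounded_swapVars (x := 7) (y := 9) (by decide) h.bounded
  have b2 := bounded_swapVars (x := 10) (y := 12) (by decide) b1
  have b3 := bounded_swapVars (x := 11) (y := 13) (by decide) b2
  obtain ⟨v1, a1⟩ := denote_swapVars (x := 7) (y := 9) (by decide) s
  obtain ⟨v2, a2⟩ := denote_swapVars (x := 10) (y := 12) (by decide) ((swapVars 7 9).denote s)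
  obtain ⟨v3, a3⟩ := denote_swapVars (x := 11) (y := 13) (by decide)
    ((swapVars 10 12).denote ((swapVars 7 9).denote s))
  refine ⟨⟨b3, ?_, ?_, ?_, ?_, ?_, ?_, ?_, ?_, ?_, ?_, ?_⟩, ?_⟩
  · rw [a3, a2, a1, h.arr]
  all_goals
    simp only [v3, v2, v1, Nat.reduceEqDiff, if_false, if_true, OfNat.one_ne_ofNat]
  · exact h.count
  · exact h.diam
  · exact h.lines
  · exact h.counter
  · exact h.snd
  · rw [h.mixed]; simp only [form]; ring
  · exact h.fst
  · rw [cross_swap, neg_sq]; exact h.det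
  · exact h.snd_le
  · exact h.fst_le

theorem denote_sizeReduce (s : State) :
    let m := (2 * s.var 8 + s.var 7) / (2 * s.var 7)
    sizeReduce.denote s = ((((s.setVar 16 m).setVar 9
      (s.var 9 - 2 * m * s.var 8 + m ^ 2 * s.var 7)).setVar 8 (s.var 8 - m * s.var 7)).setVar 12
      (s.var 12 - m * s.var 10)).setVar 13 (s.var 13 - m * s.var 11) := by
  simp only [sizeReduce, Prog.denote, Expr.eval_sub, Expr.eval_div,
    Expr.eval, State.setVar_var, Nat.reduceEqDiff, if_false, if_true, sq]

theorem BasisInv.sizeReduce (hin : InputData V inp n c L) (ht : IsMaxTriangle V w e e') {s : State}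
    (h : BasisInv inp n c L e e' s) :
    BasisInv inp n c L e e' (sizeReduce.denote s) ∧ (sizeReduce.denote s).var 7 = s.var 7 ∧
      |2 * (sizeReduce.denote s).var 8| ≤ (sizeReduce.denote s).var 7 := by
  have hD := ht.cross_pos hin.span
  have hc := hin.one_le_coord
  have ha : 0 < s.var 7 := h.fst ▸ form_pos hD.ne' h.fst_ne_zero
  have hcpos : 0 < s.var 9 := h.snd ▸ form_pos hD.ne' h.snd_ne_zero
  have hred := round_reduced (b := s.var 8) ha
  have hdec := round_decreases (b := s.var 8) (c := s.var 9) ha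
  -- The Gram determinant is nonnegative, so the square of the mixed coefficient is at most the
  -- product of the diagonal ones.
  have hb : |s.var 8| ≤ 8 * c ^ 2 := by
    have hg := form_gram e e' (s.var 10, s.var 11) (s.var 12, s.var 13)
    rw [← h.fst, ← h.mixed, ← h.snd] at hg
    have : s.var 8 ^ 2 ≤ (8 * c ^ 2) ^ 2 := by
      nlinarith [sq_nonneg (cross e e' * cross (s.var 10, s.var 11) (s.var 12, s.var 13)),
        mul_le_mul h.fst_le h.snd_le hcpos.le (by positivity)]
    exact abs_le_of_sq_le_sq this (by positivity)
  have hm : |(2 * s.var 8 + s.var 7) / (2 * s.var 7)| ≤ 24 * c ^ 2 := by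
    refine (Int.abs_ediv_le_abs _ _).trans ?_
    have h1 := abs_le.1 hb
    have h2 := h.fst_le
    rw [abs_le]
    constructor <;> linarith
  rw [denote_sizeReduce]
  generalize (2 * s.var 8 + s.var 7) / (2 * s.var 7) = m at *
  have hsnd : s.var 9 - 2 * m * s.var 8 + m ^ 2 * s.var 7 =
      form e e' (s.var 12 - m * s.var 10, s.var 13 - m * s.var 11)
        (s.var 12 - m * s.var 10, s.var 13 - m * s.var 11) := by
    rw [h.fst, h.mixed, h.snd]
    simp only [form, cross]; ring
  have hedge : ∀ p : ℤ × ℤ, w + p ∈ V → |p.1| ≤ 2 * c ∧ |p.2| ≤ 2 * c := fun p hp => by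
    have := hin.coord_sub hp ht.mem
    rwa [add_sub_cancel_left] at this
  have hle : s.var 9 - 2 * m * s.var 8 + m ^ 2 * s.var 7 ≤ 8 * c ^ 2 := hdec.trans h.snd_le
  obtain ⟨k1, k2⟩ := abs_coord_le_of_form_le hD (hedge e ht.mem_add) (hedge e' ht.mem_add')
    (hsnd ▸ hle)
  have hpos : 0 ≤ s.var 9 - 2 * m * s.var 8 + m ^ 2 * s.var 7 := by
    rw [hsnd]; exact add_nonneg (mul_self_nonneg _) (mul_self_nonneg _)
  have hcsq : 0 ≤ c ^ 2 := sq_nonneg c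
  have hccube : 0 ≤ c ^ 3 := pow_nonneg (by linarith) 3
  refine ⟨⟨?_, h.arr, ?_, ?_, ?_, ?_, ?_, ?_, ?_, ?_, ?_, ?_⟩, ?_, ?_⟩ <;>
    try simp only [State.setVar_var, Nat.reduceEqDiff, if_false, if_true, OfNat.one_ne_ofNat]
  · refine ((((h.bounded.setVar 16 ?_).setVar 9 ?_).setVar 8 ?_).setVar 12 ?_).setVar 13 ?_
    · exact hin.le_of_le_sq (hm.trans (by linarith))
    · exact hin.le_of_le_sq ((abs_of_nonneg hpos).trans_le (hle.trans (by linarith)))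
    · refine hin.le_of_le_sq (le_trans ?_ (by linarith : 8 * c ^ 2 ≤ 4096 * c ^ 2))
      have h1 := abs_le.1 hred
      have h2 := h.fst_le
      rw [abs_le]
      constructor <;> linarith
    · exact hin.le_of_le_cube (k1.trans (by linarith))
    · exact hin.le_of_le_cube (k2.trans (by linarith))
  · exact h.count
  · exact h.diam
  · exact h.lines
  · exact h.counter
  · exact h.fst
  · rw [h.mixed, h.fst]; simp only [form, cross]; ring
  · exact hsnd
  · rw [← h.det]; simp only [cross]; ring
  · exact h.fst_le
  · exact hle
  · exact hred

/-- The first coefficient more than halves in each round, so its bit length k counts the rounds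
left. -/
structure GaussInv (inp : ℤ → ℤ) (n c : ℤ) (L : ℕ) (e e' : ℤ × ℤ) (k : ℕ) (s : State) : Prop where
  basis : BasisInv inp n c L e e' s
  reduced : |2 * s.var 8| ≤ s.var 7
  lt : s.var 7 < 2 ^ k

theorem GaussInv.step (hin : InputData V inp n c L) (ht : IsMaxTriangle V w e e') {k : ℕ}
    {s : State} (h : GaussInv inp n c L e e' k s)
    (hpos : 0 < (.var 7 - .const 2 * .var 9 : Expr).eval s) :
    ∃ k' < k, GaussInv inp n c L e e' k' (gaussBody.denote s) := by
  have hpos' : 0 < s.var 7 - 2 * s.var 9 := hpos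
  have hc : 0 < s.var 9 :=
    h.basis.snd ▸ form_pos (ht.cross_pos hin.span).ne' h.basis.snd_ne_zero
  have hlt := h.lt
  obtain ⟨k, rfl⟩ : ∃ k', k = k' + 1 := by
    refine Nat.exists_eq_succ_of_ne_zero ?_
    rintro rfl
    simp at hlt
    omega
  obtain ⟨hs, h7⟩ := h.basis.swap
  obtain ⟨hr, h7', hred⟩ := hs.sizeReduce hin ht
  refine ⟨k, Nat.lt_succ_self k, hr, hred, ?_⟩
  change (Algorithm.sizeReduce.denote _).var 7 < _
  rw [h7', h7]
  rw [pow_succ] at hlt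
  omega

theorem gaussInit_inv (hin : InputData V inp n c L) {s : State}
    (ht : IsMaxTriangle V w (s.var 3, s.var 4) (s.var 5, s.var 6)) {k : ℕ}
    (h : AreaInv V inp n L k s) :
    GaussInv inp n c L (s.var 3, s.var 4) (s.var 5, s.var 6) (L + 1) (gaussInit.denote s) := by
  have hc := hin.one_le_coord
  have hcsq : 1 ≤ c ^ 2 := one_le_pow₀ hc
  have hedge : ∀ p : ℤ × ℤ, w + p ∈ V → |p.1| ≤ 2 * c ∧ |p.2| ≤ 2 * c := fun p hp => by
    have := hin.coord_sub hp ht.mem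
    rwa [add_sub_cancel_left] at this
  obtain ⟨h3, h4⟩ := hedge _ ht.mem_add
  obtain ⟨h5, h6⟩ := hedge _ ht.mem_add'
  simp only at h3 h4 h5 h6
  have mul_le : ∀ x y : ℤ, |x| ≤ 2 * c → |y| ≤ 2 * c → |x * y| ≤ 4 * c ^ 2 := fun x y hx hy => by
    rw [abs_mul]
    exact (mul_le_mul hx hy (abs_nonneg _) (by linarith)).trans_eq (by ring)
  have hsum : ∀ x y z t : ℤ, |x| ≤ 2 * c → |y| ≤ 2 * c → |z| ≤ 2 * c → |t| ≤ 2 * c →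
      |x * y + z * t| ≤ 8 * c ^ 2 := fun x y z t hx hy hz ht => by
    have := abs_add_le (x * y) (z * t)
    linarith [mul_le x y hx hy, mul_le z t hz ht]
  have h7 := hsum _ _ _ _ h4 h4 h6 h6
  have h8 := hsum _ _ _ _ h4 h3 h6 h5
  have h9 := hsum _ _ _ _ h3 h3 h5 h5
  have big : ∀ z : ℤ, |z| ≤ 8 * c ^ 2 → |z| ≤ 2 ^ L := fun z hz => hin.le_of_le_sq (by linarith)
  set t := ((((((((s.setVar 1 0).setVar 7 (s.var 4 * s.var 4 + s.var 6 * s.var 6)).setVar 8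
    (0 - (s.var 4 * s.var 3 + s.var 6 * s.var 5))).setVar 9
    (s.var 3 * s.var 3 + s.var 5 * s.var 5)).setVar 10 1).setVar 11 0).setVar 12 0).setVar 13 1)
    with htdef
  have hden : gaussInit.denote s = Algorithm.sizeReduce.denote t := by
    simp only [gaussInit, Prog.denote, Expr.eval_sub,
      Expr.eval, State.setVar_var, Nat.reduceEqDiff, if_false, OfNat.ofNat_ne_one, htdef]
  have hbasis : BasisInv inp n c L (s.var 3, s.var 4) (s.var 5, s.var 6) t := by
    refine ⟨?_, h.arr, ?_, ?_, ?_, ?_, ?_, ?_, ?_, ?_, ?_, ?_⟩ <;>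
      simp only [htdef, State.setVar_var, Nat.reduceEqDiff, if_false, if_true, OfNat.ofNat_ne_one,
        OfNat.one_ne_ofNat]
    · have one : |(1 : ℤ)| ≤ 2 ^ L := big 1 (by rw [abs_one]; linarith)
      have zero : |(0 : ℤ)| ≤ 2 ^ L := big 0 (by rw [abs_zero]; linarith)
      refine (((((((h.bounded.setVar 1 zero).setVar 7 (big _ h7)).setVar 8 ?_).setVar 9
        (big _ h9)).setVar 10 one).setVar 11 zero).setVar 12 zero).setVar 13 one
      rw [zero_sub, abs_neg]
      exact big _ h8
    · exact h.count
    · exact h.diam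
    · exact h.lines
    · simp only [form, cross]; ring
    · simp only [form, cross]; ring
    · simp only [form, cross]; ring
    · simp [cross]
    · exact (le_abs_self _).trans h7
    · exact (le_abs_self _).trans h9
  rw [hden]
  obtain ⟨g1, g2, g3⟩ := hbasis.sizeReduce hin ht
  refine ⟨g1, g3, ?_⟩
  -- The first coefficient is at most 2 ^ L, and the strict bound of the invariant asks for one more
  -- bit.
  have := hin.le_of_le_sq (g1.fst_le.trans (by linarith : 8 * c ^ 2 ≤ 4096 * c ^ 2))
  rw [pow_succ]
  linarith [pow_pos (show (0 : ℤ) < 2 by norm_num) L]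

end Gauss

end LatticeDiameter.Algorithm

/-! ### Correctness of the search over candidate directions and triples -/

namespace LatticeDiameter.Algorithm

open RAM

section Chord

variable {V : Finset (ℤ × ℤ)} {inp : ℤ → ℤ} {n c : ℤ} {L : ℕ} {w e e' b b' : ℤ × ℤ}

/-- A reduced lattice basis for the quadratic form of a triangle of maximal area. -/
structure ReducedBasis (V : Finset (ℤ × ℤ)) (c : ℤ) (b b' : ℤ × ℤ) : Prop where
  coord : |b.1| ≤ 32 * c ^ 3 ∧ |b.2| ≤ 32 * c ^ 3
  coord' : |b'.1| ≤ 32 * c ^ 3 ∧ |b'.2| ≤ 32 * c ^ 3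
  coeff : ∀ x v : ℤ × ℤ, toReal x ∈ hull V →
    toReal (x + (latticeDiam (hull V) : ℤ) • v) ∈ hull V →
    ∃ y z : ℤ, |y| ≤ 16 ∧ |z| ≤ 16 ∧ v = y • b + z • b'

/-- A diameter direction v satisfies Q(v) < 64 Q(b) for the first basis vector b, and `abs_coeff_le`
turns this into the bound 16. The bound 32 c³ comes from Q ≤ 8c² and edge coordinates at most 2c. -/
theorem GaussInv.reducedBasis (hin : InputData V inp n c L) (ht : IsMaxTriangle V w e e') {k : ℕ}
    {s : State} (h : GaussInv inp n c L e e' k s)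
    (hpos : ¬ 0 < (.var 7 - .const 2 * .var 9 : Expr).eval s) :
    ReducedBasis V c (s.var 10, s.var 11) (s.var 12, s.var 13) := by
  have hpos' : ¬ 0 < s.var 7 - 2 * s.var 9 := hpos
  have hD := ht.cross_pos hin.span
  have hedge : ∀ p : ℤ × ℤ, w + p ∈ V → |p.1| ≤ 2 * c ∧ |p.2| ≤ 2 * c := fun p hp => by
    have := hin.coord_sub hp ht.mem
    rwa [add_sub_cancel_left] at this
  have e32 : 2 * (8 * c ^ 2 * (2 * c)) = 32 * c ^ 3 := by ring
  have h1 := abs_coord_le_of_form_le hD (hedge e ht.mem_add) (hedge e' ht.mem_add')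
    (h.basis.fst ▸ h.basis.fst_le)
  have h2 := abs_coord_le_of_form_le hD (hedge e ht.mem_add) (hedge e' ht.mem_add')
    (h.basis.snd ▸ h.basis.snd_le)
  rw [e32] at h1 h2
  refine ⟨h1, h2, fun x v hx hy => ?_⟩
  have hlt := ht.form_lt hin.span hx hy h.basis.fst_ne_zero
  obtain ⟨y, z, rfl⟩ := exists_basis_coeff h.basis.det v
  rw [form_comb, ← h.basis.fst, ← h.basis.mixed, ← h.basis.snd] at hlt
  obtain ⟨hy', hz'⟩ := abs_coeff_le (h.basis.fst ▸ form_pos hD.ne' h.basis.fst_ne_zero) h.reduced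
    (by omega) hlt
  exact ⟨y, z, hy', hz', rfl⟩

/-- The step number has the triple as remainder modulo n³. Its quotient has the two coefficients,
shifted by 16, as base 33 digits. -/
theorem exists_step (hin : InputData V inp n c L) {p q r : ℤ × ℤ} (hp : p ∈ V) (hq : q ∈ V)
    (hr : r ∈ V) {y z : ℤ} (hy : |y| ≤ 16) (hz : |z| ≤ 16) (b b' : ℤ × ℤ) :
    ∃ j, 0 ≤ j ∧ j < 1089 * (n * n * n) ∧ triFst inp n (triIdx n j) = p ∧
      triSnd inp n (triIdx n j) = q ∧ triTrd inp n (triIdx n j) = r ∧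
      cand n b b' j = y • b + z • b' := by
  obtain ⟨i, hi0, hi1, h1, h2, h3⟩ := hin.exists_tri hp hq hr
  rw [abs_le] at hy hz
  have hpos := hin.cube_pos
  have key : ∀ N : ℤ, 0 < N → i < N →
      ∃ j, 0 ≤ j ∧ j < 1089 * N ∧ j - N * (j / N) = i ∧ j / N = (y + 16) * 33 + (z + 16) := by
    intro N hN hi
    have hdiv : (i + ((y + 16) * 33 + (z + 16)) * N) / N = (y + 16) * 33 + (z + 16) := by
      rw [Int.add_mul_ediv_right _ _ hN.ne', Int.ediv_eq_zero_of_lt hi0 hi, zero_add]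
    refine ⟨i + ((y + 16) * 33 + (z + 16)) * N, ?_, ?_, ?_, hdiv⟩
    · have : 0 ≤ (y + 16) * 33 + (z + 16) := by omega
      positivity
    · have : (y + 16) * 33 + (z + 16) + 1 ≤ 1089 := by omega
      nlinarith
    · rw [hdiv]; ring
  obtain ⟨j, hj0, hj1, hji, hjq⟩ := key _ hpos hi1
  have hidx : triIdx n j = i := hji
  refine ⟨j, hj0, hj1, by rw [hidx, h1], by rw [hidx, h2], by rw [hidx, h3], ?_⟩
  rw [cand, hjq]
  have e1 : ((y + 16) * 33 + (z + 16)) / 33 = y + 16 := by omega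
  rw [e1]
  congr 2 <;> ring

theorem cand_ne_zero {j : ℤ} (h : Valid inp n b b' j) : cand n b b' j ≠ 0 := by
  intro h0
  have := h.2.2
  simp [sndOffset, trdOffset, h0, cross] at this

theorem chord_mem (hin : InputData V inp n c L) {j : ℤ} (h : Valid inp n b b' j)
    (hk : 0 ≤ chord inp n b b' j) :
    toReal (triFst inp n (triIdx n j)) ∈ hull V ∧
      toReal (triFst inp n (triIdx n j) + chord inp n b b' j • cand n b b' j) ∈ hull V := by
  obtain ⟨hp, hq, hr⟩ := hin.tri_mem (hin.triIdx_nonneg j) (hin.triIdx_lt j)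
  refine ⟨subset_convexHull ℝ _ ⟨_, hp, rfl⟩, add_smul_mem_hull hp hq hr h.1 h.2.1 h.2.2 hk ?_⟩
  exact Int.ediv_mul_le _ (by have := h.2.2; omega)

theorem chord_le_latticeDiam (hin : InputData V inp n c L) {j : ℤ} (h : Valid inp n b b' j) :
    chord inp n b b' j ≤ latticeDiam (hull V) := by
  by_contra! hlt
  obtain ⟨h1, h2⟩ := chord_mem hin h (by omega)
  obtain ⟨k, hk⟩ := Int.eq_ofNat_of_zero_le (show 0 ≤ chord inp n b b' j by omega)
  rw [hk] at h2 hlt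
  have := le_latticeDiam (cand_ne_zero h) h1 h2
  omega

/-- Every direction of a lattice diameter line is found in some step. -/
theorem exists_valid_step (hin : InputData V inp n c L) (hb : ReducedBasis V c b b') {x v : ℤ × ℤ}
    (hv : v ≠ 0) (hx : toReal x ∈ hull V)
    (hy : toReal (x + (latticeDiam (hull V) : ℤ) • v) ∈ hull V) :
    ∃ j, 0 ≤ j ∧ j < 1089 * (n * n * n) ∧ Valid inp n b b' j ∧
      chord inp n b b' j = latticeDiam (hull V) ∧ (cand n b b' j = v ∨ cand n b b' j = -v) := by
  obtain ⟨u, hu, p, hp, q, hq, r, hr, h1, h2, h3, h4⟩ := exists_vertex_triple hin.span hv hx hy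
    (by rw [toReal_add, toReal_smul])
  obtain ⟨y, z, hy16, hz16, hyz⟩ : ∃ y z : ℤ, |y| ≤ 16 ∧ |z| ≤ 16 ∧ u = y • b + z • b' := by
    rcases hu with rfl | rfl
    · exact hb.coeff x u hx hy
    -- For -v the same diameter chord is read from its other end.
    · exact hb.coeff _ _ hy (by rwa [smul_neg, add_neg_cancel_right])
  obtain ⟨j, hj0, hj1, rfl, rfl, rfl, hcand⟩ := exists_step hin hp hq hr hy16 hz16 b b'
  rw [← hyz] at hcand
  rw [← hcand] at h1 h2 h3 h4 hu
  have hvalid : Valid inp n b b' j := ⟨h1, h2, h3⟩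
  refine ⟨j, hj0, hj1, hvalid, le_antisymm (chord_le_latticeDiam hin hvalid) ?_, hu⟩
  -- The inequality certifying the triple says that d is at most the floor of the quotient, so this
  -- step attains the diameter.
  exact (Int.le_ediv_iff_mul_le (sub_pos.2 h3)).2 h4

/-- The state of the search before step `j`. -/
structure Progress (inp : ℤ → ℤ) (n : ℤ) (b b' : ℤ × ℤ) (j d : ℤ)
    (lines : List ((ℤ × ℤ) × (ℤ × ℤ))) : Prop where
  nonneg : 0 ≤ d
  length_le : (lines.length : ℤ) ≤ j
  sound : ∀ l ∈ lines, ∃ i, Valid inp n b b' i ∧ chord inp n b b' i = d ∧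
    l = candLine inp n b b' i
  complete : ∀ i, 0 ≤ i → i < j → Valid inp n b b' i → chord inp n b b' i ≤ d ∧
    (chord inp n b b' i = d → candLine inp n b b' i ∈ lines)
  attained : d = 0 ∨ lines ≠ []

namespace Progress

variable {j d : ℤ} {lines : List ((ℤ × ℤ) × (ℤ × ℤ))}

theorem skip (h : Progress inp n b b' j d lines)
    (hj : Valid inp n b b' j → chord inp n b b' j < d) :
    Progress inp n b b' (j + 1) d lines := by
  refine ⟨h.nonneg, by linarith [h.length_le], h.sound, fun i hi0 hi1 hi => ?_, h.attained⟩
  rcases (Int.lt_add_one_iff.1 hi1).lt_or_eq with hlt | rfl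
  · exact h.complete i hi0 hlt hi
  · exact ⟨(hj hi).le, fun heq => absurd heq (hj hi).ne⟩

theorem append (h : Progress inp n b b' j d lines) (hj : Valid inp n b b' j)
    (hd : chord inp n b b' j = d) :
    Progress inp n b b' (j + 1) d (lines ++ [candLine inp n b b' j]) := by
  refine ⟨h.nonneg, ?_, ?_, fun i hi0 hi1 hi => ?_, .inr (by simp)⟩
  · push_cast [List.length_append, List.length_singleton]
    linarith [h.length_le]
  · intro l hl
    rcases List.mem_append.1 hl with hl | hl
    · exact h.sound l hl
    · exact ⟨j, hj, hd, List.mem_singleton.1 hl⟩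
  · rcases (Int.lt_add_one_iff.1 hi1).lt_or_eq with hlt | rfl
    · obtain ⟨h1, h2⟩ := h.complete i hi0 hlt hi
      exact ⟨h1, fun heq => List.mem_append_left _ (h2 heq)⟩
    · exact ⟨hd.le, fun _ => by simp⟩

theorem restart (h : Progress inp n b b' j d lines) (hj0 : 0 ≤ j) (hj : Valid inp n b b' j)
    (hd : d < chord inp n b b' j) :
    Progress inp n b b' (j + 1) (chord inp n b b' j) [candLine inp n b b' j] := by
  refine ⟨by linarith [h.nonneg], by simpa using hj0, ?_, fun i hi0 hi1 hi => ?_, .inr (by simp)⟩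
  · intro l hl
    exact ⟨j, hj, rfl, List.mem_singleton.1 hl⟩
  · rcases (Int.lt_add_one_iff.1 hi1).lt_or_eq with hlt | rfl
    · have := (h.complete i hi0 hlt hi).1
      exact ⟨by linarith, fun heq => by linarith⟩
    · exact ⟨le_rfl, fun _ => by simp⟩

/-- All steps are done, so d is at least the diameter. This is positive, so by `attained` the list
is nonempty, and any line in it comes from a lattice chord of length d. -/
theorem eq_latticeDiam (h : Progress inp n b b' j d lines) (hin : InputData V inp n c L)
    (hb : ReducedBasis V c b b') (hj : 1089 * (n * n * n) ≤ j) : d = latticeDiam (hull V) := by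
  have hpos := one_le_latticeDiam hin.span
  obtain ⟨x, u, hu, hx, hy⟩ := exists_latticeDiam hin.span
  obtain ⟨i, hi0, hi1, hi, hchord, -⟩ := exists_valid_step hin hb hu hx hy
  have hle := (h.complete i hi0 (by omega) hi).1
  refine le_antisymm ?_ (hchord ▸ hle)
  rcases h.attained with h0 | hne
  · omega
  · obtain ⟨l, hl⟩ := List.exists_mem_of_ne_nil _ hne
    obtain ⟨i', hi', rfl, -⟩ := h.sound l hl
    exact chord_le_latticeDiam hin hi'

theorem isDiameterLine (h : Progress inp n b b' j d lines) (hin : InputData V inp n c L)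
    (hd : d = latticeDiam (hull V)) {l : (ℤ × ℤ) × (ℤ × ℤ)} (hl : l ∈ lines) :
    IsDiameterLine (hull V) (lineThrough l) := by
  obtain ⟨i, hi, hchord, rfl⟩ := h.sound l hl
  obtain ⟨h1, h2⟩ := chord_mem hin hi (by omega)
  rw [hchord, hd] at h2
  exact isDiameterLine_lineThrough hin.span (cand_ne_zero hi) h1 h2

theorem exists_hasDirection (h : Progress inp n b b' j d lines) (hin : InputData V inp n c L)
    (hb : ReducedBasis V c b b') (hj : 1089 * (n * n * n) ≤ j) {M : AffineSubspace ℝ (ℝ × ℝ)}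
    (hM : IsDiameterLine (hull V) M) {u : ℝ × ℝ} (hu : HasDirection M u) :
    ∃ l ∈ lines, HasDirection (lineThrough l) u := by
  obtain ⟨x, v, hv, hx, hy, hspan⟩ := hM.exists_direction hin.span hu
  obtain ⟨i, hi0, hi1, hi, hchord, hcand⟩ := exists_valid_step hin hb hv hx hy
  have hd := h.eq_latticeDiam hin hb hj
  refine ⟨_, (h.complete i hi0 (by omega) hi).2 (hchord.trans hd.symm),
    hasDirection_lineThrough ?_⟩
  rcases hcand with hc | hc
  · rw [hc, hspan]
  · rw [hc, ← hspan, ← span_toReal_smul v (show (-1 : ℤ) ≠ 0 by norm_num), neg_one_smul]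

end Progress

theorem View.advance {s : State} {j : ℤ} (h : View s inp n b b' j) (z : ℤ) :
    View (s.setVar 1 z) inp n b b' z :=
  ⟨h.arr, h.count, by simp [State.setVar_var], h.fst, h.snd⟩

structure ChordInv (inp : ℤ → ℤ) (n : ℤ) (L : ℕ) (b b' : ℤ × ℤ) (k : ℕ) (s : State) : Prop where
  bounded : s.Bounded L
  view : View s inp n b b' (s.var 1)
  counter_nonneg : 0 ≤ s.var 1
  remaining : (k : ℤ) = 1089 * (n * n * n) - s.var 1
  progress : ∃ d lines, Stored s d lines ∧ Progress inp n b b' (s.var 1) d lines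

theorem ChordInv.of_bounded {s t : State} {k : ℕ} {j d : ℤ} {lines : List ((ℤ × ℤ) × (ℤ × ℤ))}
    (hb : t.Bounded L) (hj : |j + 1| ≤ 2 ^ L) (hv : View t inp n b b' j) (hj0 : 0 ≤ j)
    (hk : ((k + 1 : ℕ) : ℤ) = 1089 * (n * n * n) - j)
    (hs : Stored t d lines) (hp : Progress inp n b b' (j + 1) d lines)
    (h : s = t.setVar 1 (t.var 1 + 1)) : ChordInv inp n L b b' k s := by
  rw [hv.counter] at h
  have h1 : (t.setVar 1 (j + 1)).var 1 = j + 1 := by simp [State.setVar_var]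
  subst h
  refine ⟨hb.setVar 1 hj, ?_, ?_, ?_, d, lines, ⟨?_, ?_, hs.cells⟩, ?_⟩
  · rw [h1]; exact hv.advance _
  · rw [h1]; omega
  · rw [h1]; push_cast at hk; linarith
  · simpa [State.setVar_var] using hs.diam
  · simpa [State.setVar_var] using hs.length
  · rw [h1]; exact hp

/-- Coefficients at most 16 and basis coordinates at most 32 c³ give c + 1024 c³, within the
allowance 4096 c³ of `InputData`. -/
theorem abs_candLine_le (hin : InputData V inp n c L) (hb : ReducedBasis V c b b') {j : ℤ}
    (h0 : 0 ≤ j) (h1 : j < 1089 * (n * n * n)) :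
    |(candLine inp n b b' j).1.1| ≤ 2 ^ L ∧ |(candLine inp n b b' j).1.2| ≤ 2 ^ L ∧
      |(candLine inp n b b' j).2.1| ≤ 2 ^ L ∧ |(candLine inp n b b' j).2.2| ≤ 2 ^ L := by
  obtain ⟨hp, -, -⟩ := hin.tri_mem (hin.triIdx_nonneg j) (hin.triIdx_lt j)
  have hp := hin.coord _ hp
  have hc := hin.one_le_coord
  have hc3 : c ≤ c ^ 3 := le_self_pow₀ hc (by norm_num)
  have hq0 : 0 ≤ j / (n * n * n) := Int.ediv_nonneg h0 hin.cube_pos.le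
  have hq1 : j / (n * n * n) < 1089 := Int.ediv_lt_of_lt_mul hin.cube_pos h1
  simp only [candLine, cand, Prod.fst_add, Prod.snd_add, Prod.smul_fst, Prod.smul_snd, smul_eq_mul]
  generalize j / (n * n * n) = q at *
  have hx : |q / 33 - 16| ≤ 16 := abs_le.2 ⟨by omega, by omega⟩
  have hy : |q - 33 * (q / 33) - 16| ≤ 16 := abs_le.2 ⟨by omega, by omega⟩
  generalize q / 33 - 16 = x at *
  generalize q - 33 * (q / 33) - 16 = y at *
  have comb : ∀ p s t : ℤ, |p| ≤ c → |s| ≤ 32 * c ^ 3 → |t| ≤ 32 * c ^ 3 →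
      |p + (x * s + y * t)| ≤ 2 ^ L := by
    intro p s t hp hs ht
    have k1 : |x * s| ≤ 16 * (32 * c ^ 3) := by
      rw [abs_mul]; exact mul_le_mul hx hs (abs_nonneg _) (by norm_num)
    have k2 : |y * t| ≤ 16 * (32 * c ^ 3) := by
      rw [abs_mul]; exact mul_le_mul hy ht (abs_nonneg _) (by norm_num)
    have k3 := abs_add_le p (x * s + y * t)
    have k4 := abs_add_le (x * s) (y * t)
    exact hin.le_of_le_cube (by linarith)
  exact ⟨hin.le_of_le_coord (by linarith [hp.1]), hin.le_of_le_coord (by linarith [hp.2]),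
    comb _ _ _ hp.1 hb.coord.1 hb.coord'.1, comb _ _ _ hp.2 hb.coord.2 hb.coord'.2⟩

theorem ChordInv.step (hin : InputData V inp n c L) (hb : ReducedBasis V c b b') {k : ℕ} {s : State}
    (h : ChordInv inp n L b b' k s) (hpos : 0 < (.const 1089 * cubeExpr - .var 1 : Expr).eval s) :
    ∃ k' < k, ChordInv inp n L b b' k' (chordBody.denote s) := by
  have hj1 : s.var 1 < 1089 * (n * n * n) := by
    have : (.const 1089 * cubeExpr - .var 1 : Expr).eval s =
      1089 * (s.var 17 * s.var 17 * s.var 17) - s.var 1 := rfl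
    rw [this, h.view.count] at hpos
    omega
  have hj0 := h.counter_nonneg
  have hrem := h.remaining
  obtain ⟨k, rfl⟩ : ∃ k', k = k' + 1 := Nat.exists_eq_succ_of_ne_zero (by
    rintro rfl
    simp only [Nat.cast_zero] at hrem
    omega)
  refine ⟨k, Nat.lt_succ_self k, ?_⟩
  obtain ⟨d, lines, hs, hp⟩ := h.progress
  have hview := h.view
  generalize hj : s.var 1 = j at *
  have hjB : |j + 1| ≤ 2 ^ L := by
    have := hin.cube_le
    rw [abs_of_nonneg (by omega)]; omega
  have c1 : (sndOffsetExpr + .const 1 : Expr).eval s = sndOffset inp n b b' j + 1 := by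
    rw [Expr.eval_add, hview.eval_sndOffset]; rfl
  have c2 : (.const 1 - trdOffsetExpr : Expr).eval s = 1 - trdOffset inp n b b' j := by
    rw [Expr.eval_sub, hview.eval_trdOffset]; rfl
  have c3 : (sndOffsetExpr - trdOffsetExpr : Expr).eval s =
      sndOffset inp n b b' j - trdOffset inp n b b' j := by
    rw [Expr.eval_sub, hview.eval_sndOffset, hview.eval_trdOffset]
  rw [chordBody, Prog.denote_seq, Prog.denote_assign]
  have incr : ∀ t : State, (.var 1 + .const 1 : Expr).eval t = t.var 1 + 1 := fun t => rfl
  have invalid : ¬ Valid inp n b b' j → ChordInv inp n L b b' k (s.setVar 1 (s.var 1 + 1)) :=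
    fun hno => ChordInv.of_bounded h.bounded hjB hview hj0 hrem hs
      (hp.skip fun hv => absurd hv hno) rfl
  rw [incr]
  by_cases h1 : 0 ≤ sndOffset inp n b b' j
  swap
  · rw [Prog.denote_cond_neg (by rw [c1]; omega)]
    exact invalid fun hv => h1 hv.1
  rw [Prog.denote_cond_pos (by rw [c1]; omega)]
  by_cases h2 : trdOffset inp n b b' j ≤ 0
  swap
  · rw [Prog.denote_cond_neg (by rw [c2]; omega)]
    exact invalid fun hv => h2 hv.2.1
  rw [Prog.denote_cond_pos (by rw [c2]; omega)]
  by_cases h3 : trdOffset inp n b b' j < sndOffset inp n b b' j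
  swap
  · rw [Prog.denote_cond_neg (by rw [c3]; omega)]
    exact invalid fun hv => h3 hv.2.2
  rw [Prog.denote_cond_pos (by rw [c3]; omega)]
  have hvalid : Valid inp n b b' j := ⟨h1, h2, h3⟩
  have hline := abs_candLine_le hin hb hj0 hj1
  have f1 : ∀ t d, View t inp n b b' j → t.var 14 = d →
      (chordExpr - .var 14 : Expr).eval t = chord inp n b b' j - d := fun t d ht hd => by
    rw [Expr.eval_sub, ht.eval_chord, ← hd]; rfl
  have f2 : ∀ t d, View t inp n b b' j → t.var 14 = d →
      (chordExpr - .var 14 + .const 1 : Expr).eval t = chord inp n b b' j - d + 1 :=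
    fun t d ht hd => by rw [Expr.eval_add, f1 t d ht hd]; rfl
  rw [Prog.denote_seq]
  rcases lt_trichotomy (chord inp n b b' j) d with hlt | heq | hgt
  · rw [Prog.denote_cond_neg (s := s) (c := chordExpr - .var 14)
      (by rw [f1 s d hview hs.diam]; omega), Prog.denote_skip,
      Prog.denote_cond_neg (by rw [f2 s d hview hs.diam]; omega)]
    exact ChordInv.of_bounded h.bounded hjB hview hj0 hrem hs (hp.skip fun _ => hlt) rfl
  · rw [Prog.denote_cond_neg (s := s) (c := chordExpr - .var 14)
      (by rw [f1 s d hview hs.diam]; omega), Prog.denote_skip,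
      Prog.denote_cond_pos (by rw [f2 s d hview hs.diam]; omega)]
    refine ChordInv.of_bounded (bounded_appendLine h.bounded hview hline ?_) hjB
      (view_appendLine hview) hj0 hrem (hs.append hview) (hp.append hvalid heq) rfl
    have := hin.cube_le
    have := hp.length_le
    rw [hs.length, abs_of_nonneg (by positivity)]
    omega
  · rw [Prog.denote_cond_pos (s := s) (c := chordExpr - .var 14)
      (by rw [f1 s d hview hs.diam]; omega)]
    have hden : (Prog.seq (.assign 14 chordExpr) (.assign 15 (.const 0))).denote s =
        (s.setVar 14 (chord inp n b b' j)).setVar 15 0 := by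
      rw [Prog.denote_seq, Prog.denote_assign, Prog.denote_assign, hview.eval_chord]; rfl
    rw [hden]
    have ht := Stored.reset s (chord inp n b b' j)
    have hvt : View ((s.setVar 14 (chord inp n b b' j)).setVar 15 0) inp n b b' j :=
      (hview.setVar (by decide) _).setVar (by decide) _
    have hbt : ((s.setVar 14 (chord inp n b b' j)).setVar 15 0).Bounded L := by
      refine (h.bounded.setVar 14 ?_).setVar 15 (by simp)
      refine (Int.abs_ediv_le_abs _ _).trans
        ((hin.abs_triArea_le (hin.triIdx_nonneg j) (hin.triIdx_lt j)).trans
          (hin.le_of_le_sq ?_))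
      nlinarith [sq_nonneg c]
    rw [Prog.denote_cond_pos (by rw [f2 _ _ hvt ht.diam]; omega)]
    refine ChordInv.of_bounded (bounded_appendLine hbt hvt hline ?_) hjB
      (view_appendLine hvt) hj0 hrem (ht.append hvt) (hp.restart hj0 hvalid hgt) rfl
    rw [ht.length]
    simpa using one_le_pow₀ (show (1 : ℤ) ≤ 2 by norm_num)

end Chord

end LatticeDiameter.Algorithm

/-! ### Output, input encoding and the polynomial time bound -/

namespace LatticeDiameter.Algorithm

open RAM

section Final

variable {V : Finset (ℤ × ℤ)} {inp : ℤ → ℤ} {n c : ℤ} {L : ℕ} {b b' : ℤ × ℤ}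

theorem denote_finish (s : State) :
    finish.denote s = (s.setCell 1 0 (s.var 14)).setVar 0 (4 * s.var 15 + 1) := rfl

theorem Stored.hasOutput {s : State} {d : ℕ} {lines : List ((ℤ × ℤ) × (ℤ × ℤ))}
    (h : Stored s d lines) : (finish.denote s).HasOutput (encodeOutput d lines) := by
  rw [denote_finish]
  have hlen := length_encodeLines lines
  have hout : (encodeOutput d lines).length = 4 * lines.length + 1 := by
    rw [encodeOutput, List.length_cons, hlen]
  refine ⟨?_, fun i hi => ?_⟩
  · rw [hout]
    simp [State.setVar_var, h.length]
  · rw [State.setVar_arr, State.setCell_arr_self]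
    rcases i with _ | i
    · simp [encodeOutput, h.diam]
    · rw [hout] at hi
      rw [if_neg (by omega)]
      push_cast
      rw [h.cells i (by omega)]
      simp only [encodeOutput, List.getElem_cons_succ]
      exact List.getD_eq_getElem _ _ _

/-- The running time of the program. -/
def time (N L : ℕ) : ℕ :=
  setup.costFactor * L + ((N ^ 3 + 1) * (areaLoop.costFactor * L) + (gaussInit.costFactor * L +
    ((L + 2) * (gaussLoop.costFactor * L) + ((1089 * N ^ 3 + 1) * (chordLoop.costFactor * L) +
      finish.costFactor * L))))

theorem program_runs {N : ℕ} (hin : InputData V inp N c L) {s : State} (hs : s.Bounded L)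
    (harr : s.arr 0 = inp) (h0 : s.var 0 = 2 * N) (hvar : ∀ x, x ≠ 0 → s.var x = 0) :
    program.Runs s (time N L) fun s' => ∃ lines : List ((ℤ × ℤ) × (ℤ × ℤ)),
      s'.HasOutput (encodeOutput (latticeDiam (hull V)) lines) ∧
      (∀ l ∈ lines, IsDiameterLine (hull V) (lineThrough l)) ∧
      ∀ u : ℝ × ℝ, (∃ M, IsDiameterLine (hull V) M ∧ HasDirection M u) →
        ∃ l ∈ lines, HasDirection (lineThrough l) u := by
  have hL := hin.one_le_log
  have hN : |(N : ℤ)| ≤ 2 ^ L := by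
    have h1 := hin.one_le_count
    have h2 := hin.cube_le
    rw [abs_of_nonneg (by omega)]
    nlinarith [mul_pos (show (0 : ℤ) < N by omega) (show (0 : ℤ) < N by omega)]
  have hset : setup.denote s = s.setVar 17 N := by
    change s.setVar 17 (s.var 0 / 2) = _
    rw [h0, Int.mul_ediv_cancel_left _ (by norm_num)]
  have hinv : AreaInv V inp N L (N ^ 3) (setup.denote s) := by
    obtain ⟨hv, -⟩ := hin.tri_mem le_rfl hin.cube_pos
    have hz : ∀ x, x ≠ 0 → x ≠ 17 → (s.setVar 17 N).var x = 0 := fun x h0 h17 => by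
      rw [State.setVar_var, if_neg h17, hvar x h0]
    rw [hset]
    have z1 := hz 1 (by decide) (by decide)
    have z2 := hz 2 (by decide) (by decide)
    have z3 := hz 3 (by decide) (by decide)
    have z4 := hz 4 (by decide) (by decide)
    have z5 := hz 5 (by decide) (by decide)
    have z6 := hz 6 (by decide) (by decide)
    -- The memory starts at zero, which encodes a degenerate triangle of area 0. Its base vertex is
    -- taken from triple 0.
    refine ⟨hs.setVar 17 hN, harr, by simp [State.setVar_var], hz 14 (by decide) (by decide),
      hz 15 (by decide) (by decide), z1.ge, ?_, ?_, z2.ge, ⟨_, hv, ?_, ?_⟩, ?_⟩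
    · rw [z1]; push_cast; ring
    · rw [z2, z3, z4, z5, z6]; simp [cross]
    · rwa [z3, z4, Prod.mk_zero_zero, add_zero]
    · rwa [z5, z6, Prod.mk_zero_zero, add_zero]
    · intro r hr0 hr1
      rw [z1] at hr1
      omega
  refine Prog.Runs.seq (Prog.LoopFree.runs (by simp [setup, Prog.LoopFree]) hL hs hinv)
    fun s₁ h₁ => ?_
  refine Prog.Runs.seq (Prog.Runs.loop (by simp [areaBody, Prog.LoopFree]) hL (AreaInv V inp N L)
    (fun _ _ h => h.bounded) (fun _ _ h => h.step hin) _ _ h₁) fun s₂ h₂ => ?_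
  obtain ⟨hexit, k, h₂⟩ := h₂
  obtain ⟨w, ht⟩ := h₂.isMaxTriangle hin hexit
  refine Prog.Runs.seq (Prog.LoopFree.runs
    (by simp [gaussInit, Algorithm.sizeReduce, Prog.LoopFree]) hL h₂.bounded
    (gaussInit_inv hin ht h₂)) fun s₃ h₃ => ?_
  refine Prog.Runs.seq (Prog.Runs.loop
    (by simp [gaussBody, swapVars, Algorithm.sizeReduce, Prog.LoopFree]) hL _
    (fun _ _ h => h.basis.bounded) (fun _ _ h => h.step hin ht) _ _ h₃) fun s₄ h₄ => ?_
  obtain ⟨hexit', k', h₄⟩ := h₄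
  have hb := h₄.reducedBasis hin ht hexit'
  have hc : ChordInv inp N L (s₄.var 10, s₄.var 11) (s₄.var 12, s₄.var 13) (1089 * N ^ 3) s₄ := by
    have z1 := h₄.basis.counter
    refine ⟨h₄.basis.bounded, ⟨h₄.basis.arr, h₄.basis.count, rfl, rfl, rfl⟩, z1.ge, ?_, 0, [],
      ⟨h₄.basis.diam, h₄.basis.lines, fun i hi => by simp at hi⟩, le_rfl, ?_, by simp, ?_, .inl rfl⟩
    · rw [z1]; push_cast; ring
    · rw [z1]; simp
    · intro i hi0 hi1
      rw [z1] at hi1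
      omega
  refine Prog.Runs.seq (Prog.Runs.loop (by simp [chordBody, appendLine, Prog.LoopFree]) hL _
    (fun _ _ h => h.bounded) (fun _ _ h => h.step hin hb) _ _ hc) fun s₅ h₅ => ?_
  obtain ⟨hexit'', k'', h₅⟩ := h₅
  refine Prog.LoopFree.runs (by simp [finish, Prog.LoopFree]) hL h₅.bounded ?_
  obtain ⟨d, lines, hst, hp⟩ := h₅.progress
  have hj : 1089 * ((N : ℤ) * N * N) ≤ s₅.var 1 := by
    have : (.const 1089 * cubeExpr - .var 1 : Expr).eval s₅ =
      1089 * (s₅.var 17 * s₅.var 17 * s₅.var 17) - s₅.var 1 := rfl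
    rw [this, h₅.view.count] at hexit''
    omega
  have hd := hp.eq_latticeDiam hin hb hj
  refine ⟨lines, (hd ▸ hst).hasOutput, fun l hl => hp.isDiameterLine hin hd hl, ?_⟩
  rintro u ⟨M, hM, hu⟩
  exact hp.exists_hasDirection hin hb hj hM hu

end Final

theorem length_encodeVertices (vs : List (ℤ × ℤ)) :
    (encodeVertices vs).length = 2 * vs.length := by
  induction vs with
  | nil => rfl
  | cons v vs ih =>
    simp only [encodeVertices, List.flatMap_cons, List.length_append, List.length_cons,
      List.length_nil] at *
    omega

theorem getD_encodeVertices (vs : List (ℤ × ℤ)) (i : ℕ) :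
    (encodeVertices vs).getD (2 * i) 0 = (vs.getD i 0).1 ∧
      (encodeVertices vs).getD (2 * i + 1) 0 = (vs.getD i 0).2 := by
  induction vs generalizing i with
  | nil => simp [encodeVertices]
  | cons v vs ih =>
    rcases i with _ | i
    · simp [encodeVertices]
    · have h1 : 2 * (i + 1) = 2 * i + 1 + 1 := by ring
      simp only [encodeVertices, List.flatMap_cons, List.cons_append, List.nil_append, h1,
        List.getD_cons_succ] at *
      exact ih i

theorem vertex_init (vs : List (ℤ × ℤ)) (i : ℕ) :
    vertex ((State.init (encodeVertices vs)).arr 0) i = vs.getD i 0 := by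
  obtain ⟨h1, h2⟩ := getD_encodeVertices vs i
  have e1 : (2 * (i : ℤ)).toNat = 2 * i := by omega
  have e2 : (2 * (i : ℤ) + 1).toNat = 2 * i + 1 := by omega
  simp only [vertex, State.init, true_and]
  rw [if_pos (by omega), if_pos (by omega), e1, e2, h1, h2]

theorem coord_le_maxAbsCoord {vs : List (ℤ × ℤ)} {v : ℤ × ℤ} (hv : v ∈ vs) :
    |v.1| ≤ maxAbsCoord vs ∧ |v.2| ≤ maxAbsCoord vs := by
  have := Finset.le_sup (f := fun v : ℤ × ℤ => max v.1.natAbs v.2.natAbs) (List.mem_toFinset.2 hv)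
  rw [maxAbsCoord]
  simp only [abs_le]
  omega

/-- The choice of L rests on 1089 ≤ 2 ^ 11 with n ≤ 2 ^ n, and on 4096 = 2 ^ 12 with c < 2 ^ (log c
+ 1). The latter needs the exponent 12 + 3 (log c + 1), hence the summand 15. -/
theorem inputData {vs : List (ℤ × ℤ)} (hspan : affineSpan ℝ (hull vs.toFinset) = ⊤) {L : ℕ}
    (hL : L = 3 * (vs.length + Nat.log 2 (maxAbsCoord vs)) + 15) :
    InputData vs.toFinset ((State.init (encodeVertices vs)).arr 0) vs.length (maxAbsCoord vs) L := by
  have hexp : ∀ m k : ℕ, m ≤ 2 ^ k → m ^ 3 ≤ 2 ^ (3 * k) := fun m k h => by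
    rw [mul_comm 3 k, pow_mul]
    exact Nat.pow_le_pow_left h 3
  have hle : ∀ m k : ℕ, k ≤ L → m ≤ 2 ^ k → m ≤ 2 ^ L := fun m k hk hm =>
    hm.trans (Nat.pow_le_pow_right (by norm_num) hk)
  refine ⟨hspan, ?_, ?_, fun p hp => coord_le_maxAbsCoord (List.mem_toFinset.1 hp), ?_, ?_, ?_, ?_,
    ?_⟩
  · intro i hi0 hi1
    lift i to ℕ using hi0
    have hi : i < vs.length := by exact_mod_cast hi1
    rw [vertex_init, List.getD_eq_getElem _ _ hi, List.mem_toFinset]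
    exact List.getElem_mem hi
  · intro p hp
    obtain ⟨i, hi, rfl⟩ := List.mem_iff_getElem.1 (List.mem_toFinset.1 hp)
    exact ⟨i, by omega, by exact_mod_cast hi, by rw [vertex_init, List.getD_eq_getElem _ _ hi]⟩
  · have hex : ∃ v ∈ vs, v ≠ 0 := by
      by_contra! hno
      obtain ⟨p, hp, hne⟩ := exists_cross_ne hspan (u := (1, 0)) (by simp) 0
      rw [hno p (List.mem_toFinset.1 hp)] at hne
      simp [cross] at hne
    obtain ⟨v, hv, hv0⟩ := hex
    have := coord_le_maxAbsCoord hv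
    simp only [abs_le] at this
    by_contra hlt
    exact hv0 (Prod.ext (by simp only [Prod.fst_zero]; omega) (by simp only [Prod.snd_zero]; omega))
  · obtain ⟨p, hp, -⟩ := exists_cross_ne hspan (u := (1, 0)) (by simp) 0
    have := List.length_pos_of_mem (List.mem_toFinset.1 hp)
    omega
  · omega
  · have h1 := hexp vs.length vs.length (Nat.lt_two_pow_self).le
    have h2 : 1089 * vs.length ^ 3 ≤ 2 ^ (11 + 3 * vs.length) := by
      rw [pow_add]; exact Nat.mul_le_mul (by norm_num) h1
    have h3 := hle _ _ (by omega) h2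
    have h4 : ((1089 * vs.length ^ 3 : ℕ) : ℤ) ≤ ((2 ^ L : ℕ) : ℤ) := by exact_mod_cast h3
    push_cast at h4
    linarith
  · have h1 := hexp (maxAbsCoord vs) (Nat.log 2 (maxAbsCoord vs) + 1)
      (Nat.lt_pow_succ_log_self (by norm_num) _).le
    have h2 : 4096 * maxAbsCoord vs ^ 3 ≤ 2 ^ (12 + 3 * (Nat.log 2 (maxAbsCoord vs) + 1)) := by
      rw [pow_add]; exact Nat.mul_le_mul (by norm_num) h1
    have h3 := hle _ _ (by omega) h2
    exact_mod_cast h3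

theorem bounded_init {vs : List (ℤ × ℤ)} {V : Finset (ℤ × ℤ)} {inp : ℤ → ℤ} {L : ℕ}
    (hin : InputData V inp vs.length (maxAbsCoord vs) L) :
    (State.init (encodeVertices vs)).Bounded L := by
  refine ⟨fun x => ?_, fun a i => ?_⟩
  · simp only [State.init]
    split_ifs
    · rw [length_encodeVertices]
      have h1 := hin.one_le_count
      have h2 := hin.cube_le
      rw [abs_of_nonneg (by positivity)]
      push_cast
      generalize (vs.length : ℤ) = m at *
      have : m ≤ m * m * m := by nlinarith [mul_self_nonneg (m - 1)]
      linarith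
    · simp
  · simp only [State.init]
    split_ifs
    · rw [List.getD_eq_getElem?_getD]
      rcases h : (encodeVertices vs)[i.toNat]? with _ | z
      · simp
      · obtain ⟨v, hv, hz⟩ := List.mem_flatMap.1 (List.mem_of_getElem? h)
        have hc := coord_le_maxAbsCoord hv
        simp only [List.mem_cons, List.not_mem_nil, or_false] at hz
        refine hin.le_of_le_coord ?_
        have h1 := hin.one_le_coord
        rcases hz with rfl | rfl
        · simp only [Option.getD_some]; linarith [hc.1]
        · simp only [Option.getD_some]; linarith [hc.2]
    · simp

/-- A polynomial bound for the running time. -/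
noncomputable def timeBound : Polynomial ℕ :=
  let X : Polynomial ℕ := Polynomial.X
  let L : Polynomial ℕ := 3 * X + 15
  (setup.costFactor : Polynomial ℕ) * L + ((X ^ 3 + 1) * ((areaLoop.costFactor : Polynomial ℕ) * L) +
    ((gaussInit.costFactor : Polynomial ℕ) * L + ((L + 2) * ((gaussLoop.costFactor : Polynomial ℕ) * L) +
      ((1089 * X ^ 3 + 1) * ((chordLoop.costFactor : Polynomial ℕ) * L) +
        (finish.costFactor : Polynomial ℕ) * L))))

theorem time_le_eval_timeBound {N m : ℕ} (h : N ≤ m) :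
    time N (3 * m + 15) ≤ timeBound.eval m := by
  simp only [time, timeBound, Polynomial.eval_add, Polynomial.eval_mul, Polynomial.eval_pow,
    Polynomial.eval_X, Polynomial.eval_natCast, Polynomial.eval_one, Polynomial.eval_ofNat,
    Nat.cast_id]
  gcongr

end LatticeDiameter.Algorithm

theorem theorem2p4 :
    ∃ (A : RAM.Prog) (q : Polynomial ℕ),
      ∀ (P : Set (ℝ × ℝ)) (vs : List (ℤ × ℤ)),
        LatticeDiameter.IsLatticePolygon P → LatticeDiameter.IsVertexList vs P →
        ∃ (lines : List ((ℤ × ℤ) × (ℤ × ℤ))) (t : ℕ),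
          A.Computes (LatticeDiameter.encodeVertices vs) t
            (LatticeDiameter.encodeOutput (LatticeDiameter.latticeDiam P) lines) ∧
          t ≤ q.eval (vs.length + Nat.log 2 (LatticeDiameter.maxAbsCoord vs)) ∧
          (∀ l ∈ lines, LatticeDiameter.IsDiameterLine P (LatticeDiameter.lineThrough l)) ∧
          (∀ u : ℝ × ℝ,
            (∃ L, LatticeDiameter.IsDiameterLine P L ∧ LatticeDiameter.HasDirection L u) →
            ∃ l ∈ lines, LatticeDiameter.HasDirection (LatticeDiameter.lineThrough l) u) := by
  refine ⟨LatticeDiameter.Algorithm.program, LatticeDiameter.Algorithm.timeBound,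
    fun P vs hP hvs => ?_⟩
  obtain rfl := hP.eq_hull hvs
  have hin := LatticeDiameter.Algorithm.inputData hP.2.1 rfl
  obtain ⟨t, ht, s, hexec, lines, hout, hlines, hdir⟩ :=
    LatticeDiameter.Algorithm.program_runs hin (LatticeDiameter.Algorithm.bounded_init hin) rfl
      (by simp [RAM.State.init, LatticeDiameter.Algorithm.length_encodeVertices])
      (fun x hx => by simp [RAM.State.init, hx])
  exact ⟨lines, t, ⟨s, hexec, hout⟩,
    ht.trans (LatticeDiameter.Algorithm.time_le_eval_timeBound (Nat.le_add_right _ _)), hlines, hdir⟩
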